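/- Let $R$ be a commutative Artinian ring and let $A$ be an $R$-algebra that is finitely generated as an $R$-module. All modules are finitely generated left $A$-modules. Suppose that $A$ is basic, and let $e_1,\dots,e_n$ be a complete set of primitive orthogonal idempotents of $A$, ordered by the index set $\Lambda=\{1<\dots<n\}$ (basic means that the modules $P(\lambda)=Ae_\lambda$ are pairwise non-isomorphic). For $\lambda\in\Lambda$ let $E(\lambda)$ be the simple top of $P(\lambda)$. The standard module $\Delta(\lambda)$ is the maximal factor module of $P(\lambda)$ without composition factors $E(\mu)$, $\mu>\lambda$. The costandard module $\nabla(\lambda)$ is the maximal submodule of the injective envelope of $E(\lambda)$ without composition factors $E(\mu)$, $\mu>\lambda$. The proper costandard module $\overline\nabla(\lambda)$ is the maximal submodule of $\nabla(\lambda)$ in which $E(\lambda)$ has composition multiplicity $1$. For a class $\Theta$ of modules, let $\mathcal F(\Theta)$ be the class of modules that have a finite filtration all of whose factors are isomorphic to members of $\Theta$. Write $\Delta=\{\Delta(\lambda)\mid\lambda\in\Lambda\}$ and $\overline\nabla=\{\overline\nabla(\lambda)\mid\lambda\in\Lambda\}$. Assume that $A$ is standardly stratified, that is, ${}_AA\in\mathcal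 F(\Delta)$. Let $T=\bigoplus_{\lambda\in\Lambda}T(\lambda)$ be the characteristic module of $A$: the modules $T(\lambda)$ are indecomposable and pairwise non-isomorphic, and $\operatorname{add}T=\mathcal F(\Delta)\cap\mathcal F(\overline\nabla)$, where $\operatorname{add}T$ is the class of modules isomorphic to a direct summand of $T^m$ for some $m\ge 0$. For a module $X$, let $\overline\nabla\text{-}\mathrm{gfd}(X)$ (the $\overline\nabla$-good filtration dimension) be the least integer $d\ge 0$ for which there is an exact sequence $$0\to X\to M_0\to\cdots\to M_d\to 0\qquad\text{with } M_0,\dots,M_d\in\mathcal F(\overline\nabla)$$ (and $\infty$ if there is no such $d$). **Proposition 2.1.** Let $X$ be a nonzero finitely generated $A$-module and let $d\ge 0$ be an integer. Then $\overline\nabla\text{-}\mathrm{gfd}(X)=d$ if and only if $\operatorname{Ext}^i_A(T,X)=0$ for all $i>d$ and $\operatorname{Ext}^d_A(T(\lambda),X)\neq 0$ for some $\lambda\in\Lambda$. -/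

import Mathlib

open CategoryTheory

universe u v

namespace StandardlyStratified

variable {A : Type u} [Ring A] {n : ℕ}

/-- An idempotent is primitive if it is nonzero and is not the sum of two nonzero orthogonal
idempotents. -/
def IsPrimitiveIdempotent (e : A) : Prop :=
  IsIdempotentElem e ∧ e ≠ 0 ∧
    ∀ f g : A, IsIdempotentElem f → IsIdempotentElem g → f * g = 0 → g * f = 0 →
      e = f + g → f = 0 ∨ g = 0

/-- The left module `P(i) = A eᵢ`. -/
abbrev P (e : Fin n → A) (i : Fin n) : Submodule A A :=
  Submodule.span A {e i}

/-- The top `E(i) = P(i) / rad P(i)` of `P(i)`. -/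
abbrev E (e : Fin n → A) (i : Fin n) : Type u :=
  P e i ⧸ Module.jacobson A (P e i)

/-- `e₀, …, eₙ₋₁` is a complete set of primitive orthogonal idempotents of the ring `A`,
and `A` is basic, that is, the modules `A eᵢ` are pairwise non-isomorphic. -/
structure IsBasicIdempotentSystem (e : Fin n → A) : Prop where
  complete : CompleteOrthogonalIdempotents e
  primitive : ∀ i, IsPrimitiveIdempotent (e i)
  basic : ∀ i j, Nonempty (P e i ≃ₗ[A] P e j) → i = j

/-- `[M : S] = k`: the module `M` has a composition series of which exactly `k` factors are
isomorphic to `S` (by the Jordan-Hölder theorem, `k` does not depend on the series). -/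
def HasMultiplicity (S M : Type u) [AddCommGroup S] [Module A S] [AddCommGroup M] [Module A M]
    (k : ℕ) : Prop :=
  ∃ s : CompositionSeries (Submodule A M), s.head = ⊥ ∧ s.last = ⊤ ∧
    {i : Fin s.length | Nonempty
      ((s i.succ ⧸ (s i.castSucc).submoduleOf (s i.succ)) ≃ₗ[A] S)}.ncard = k

/-- `M` is (isomorphic to) the standard module `Δ(i)`: the maximal factor module of `P(i)` without
composition factors `E(j)` for `j > i`. -/
def IsStandard (e : Fin n → A) (i : Fin n) (M : ModuleCat.{u} A) : Prop :=
  ∃ K : Submodule A (P e i),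
    IsLeast {K : Submodule A (P e i) | ∀ j > i, HasMultiplicity (A := A) (E e j) (P e i ⧸ K) 0} K ∧
    Nonempty (M ≃ₗ[A] (P e i ⧸ K))

/-- `I` is an injective envelope of `S` in the category of finitely generated `A`-modules. -/
def IsInjectiveEnvelope (S I : Type u) [AddCommGroup S] [Module A S]
    [AddCommGroup I] [Module A I] : Prop :=
  Module.Finite A I ∧ Module.Injective A I ∧
    ∃ f : S →ₗ[A] I, Function.Injective f ∧
      ∀ N : Submodule A I, N ⊓ LinearMap.range f = ⊥ → N = ⊥

/-- `M` is (isomorphic to) the proper costandard module `∇̄(i)`: the maximal submodule `L` of the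
costandard module `∇(i)` with `[L : E(i)] = 1`, where `∇(i)` is the maximal submodule of the
injective envelope of `E(i)` without composition factors `E(j)` for `j > i`. -/
def IsProperCostandard (e : Fin n → A) (i : Fin n) (M : ModuleCat.{u} A) : Prop :=
  ∃ I : ModuleCat.{u} A, IsInjectiveEnvelope (A := A) (E e i) I ∧
    ∃ N L : Submodule A I,
      IsGreatest {N : Submodule A I | ∀ j > i, HasMultiplicity (A := A) (E e j) N 0} N ∧
      IsGreatest {L : Submodule A I | L ≤ N ∧ HasMultiplicity (A := A) (E e i) L 1} L ∧
      Nonempty (M ≃ₗ[A] L)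

/-- The class `Δ` of all standard modules. -/
def standardClass (e : Fin n → A) : ObjectProperty (ModuleCat.{u} A) :=
  fun M => ∃ i, IsStandard e i M

/-- The class `∇̄` of all proper costandard modules. -/
def properCostandardClass (e : Fin n → A) : ObjectProperty (ModuleCat.{u} A) :=
  fun M => ∃ i, IsProperCostandard e i M

/-- `F(Θ)`: the modules `M` with a filtration `0 = F t ⊆ ⋯ ⊆ F 1 ⊆ F 0 = M` all of whose
factors belong to `Θ`. -/
def Filtered (Θ : ObjectProperty (ModuleCat.{u} A)) : ObjectProperty (ModuleCat.{u} A) :=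
  fun M => ∃ (t : ℕ) (F : ℕ → Submodule A M), F 0 = ⊤ ∧ F t = ⊥ ∧
    ∀ i < t, F (i + 1) ≤ F i ∧ Θ (ModuleCat.of A (F i ⧸ (F (i + 1)).submoduleOf (F i)))

/-- The algebra with its ordered idempotents is standardly stratified: `A` as a left module over
itself lies in `F(Δ)`. -/
def IsStandardlyStratified (e : Fin n → A) : Prop :=
  Filtered (standardClass e) (ModuleCat.of A A)

/-- `M` belongs to `add T`: it is isomorphic to a direct summand of `T^m` for some `m`. -/
def IsInAdd (T M : ModuleCat.{u} A) : Prop :=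
  ∃ (m : ℕ) (s : M →ₗ[A] (Fin m → T)) (r : (Fin m → T) →ₗ[A] M), r ∘ₗ s = LinearMap.id

/-- The module `T = ⨁ i, T(i)`. -/
abbrev total (T : Fin n → ModuleCat.{u} A) : ModuleCat.{u} A :=
  ModuleCat.of A (DirectSum (Fin n) fun i => T i)

/-- `T = ⨁ i, T(i)` is the characteristic module, decomposed into indecomposables: it is basic
(the indecomposable `T(i)` are pairwise non-isomorphic) and `add T = F(Δ) ∩ F(∇̄)`. -/
structure IsCharacteristic (e : Fin n → A) (T : Fin n → ModuleCat.{u} A) : Prop where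
  indecomposable : ∀ i, Indecomposable (T i)
  basic : ∀ i j, Nonempty (T i ≃ₗ[A] T j) → i = j
  add_eq : ∀ M : ModuleCat.{u} A, IsInAdd (total T) M ↔
    Filtered (standardClass e) M ∧ Filtered (properCostandardClass e) M

/-- There is an exact sequence `0 → X → M₀ → ⋯ → M_d → 0` with all `Mᵢ` in `F(∇̄)`; the sequence
is continued by zero modules to the right of `M_d`. -/
def HasGoodCoresolution (e : Fin n → A) (X : ModuleCat.{u} A) (d : ℕ) : Prop :=
  ∃ (M : ℕ → ModuleCat.{u} A) (ε : X →ₗ[A] M 0) (f : ∀ i, M i →ₗ[A] M (i + 1)),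
    Function.Injective ε ∧ Function.Exact ε (f 0) ∧
    (∀ i, Function.Exact (f i) (f (i + 1))) ∧
    (∀ i ≤ d, Filtered (properCostandardClass e) (M i)) ∧
    ∀ i > d, Subsingleton (M i)

/-- The `∇̄`-good filtration dimension of `X`: the least `d` such that `X` has a coresolution
`0 → X → M₀ → ⋯ → M_d → 0` with all `Mᵢ` in `F(∇̄)` (`⊤` if there is none). -/
noncomputable def goodFiltrationDimension (e : Fin n → A) (X : ModuleCat.{u} A) : ℕ∞ :=
  ⨅ (d : ℕ) (_ : HasGoodCoresolution e X d), (d : ℕ∞)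

end StandardlyStratified

/-! Everything reduces to one equivalence: `X` has a coresolution of length `k` by modules in
`F(∇̄)` if and only if `Ext^i(T, X) = 0` for all `i > k`. The dimension is the least such `k`. If it
is `d > 0`, then `Ext^d(T, X)` cannot vanish, since `d - 1` would do as well. If `d = 0`, then
`Hom(T, X)` cannot vanish, because vanishing of all `Ext^i(T, X)` would force `Hom(A, X) = X` to be
zero.

Three facts carry the equivalence. First, `Ext^k(F(Δ), F(∇̄)) = 0` for `k ≥ 1` (`fil_extZero_fil`);
as `T` lies in `F(Δ)`, dimension shifting along a coresolution gives one direction. Second, a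
finitely generated module with `Ext¹(Δ, X) = 0` lies in `F(∇̄)` (`fil_properCostandard_of_extZero`).
Third, iterated universal extensions embed any finitely generated `X` into some `Y` with `Ext¹(Δ, Y)
= 0` and cokernel in `F(Δ)` (`exists_approximation`).

For the other direction, approximate a module `M` in `F(Δ)`: the sequence `0 → M → Y → C → 0` has
`Y` in `add T`, and `C` involves only standard modules of smaller index. Hence `M` has a finite `add
T`-coresolution, and vanishing of `Ext^i(T, X)` in all degrees from some point on passes to
`Ext^i(M, X)` (`fil_extZero_of_total`). This settles `k = 0`; for larger `k`, replace `X` by the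
cokernel of its approximation. -/

namespace StandardlyStratified

/-! ### Vanishing of Ext along short exact sequences and retracts. -/

section ExtVanishing

open CategoryTheory.Abelian

variable {A : Type u} [Ring A]

/-- `Ext^k_A(M, X) = 0`. -/
abbrev ExtZero (A : Type u) [Ring A] (M X : Type u) [AddCommGroup M] [Module A M]
    [AddCommGroup X] [Module A X] (k : ℕ) : Prop :=
  Subsingleton (Ext.{u} (ModuleCat.of A M) (ModuleCat.of A X) k)

variable {M M₁ M₂ M₃ X X₁ X₂ X₃ : Type u}
  [AddCommGroup M] [Module A M] [AddCommGroup X] [Module A X]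
  [AddCommGroup M₁] [Module A M₁] [AddCommGroup M₂] [Module A M₂] [AddCommGroup M₃] [Module A M₃]
  [AddCommGroup X₁] [Module A X₁] [AddCommGroup X₂] [Module A X₂] [AddCommGroup X₃] [Module A X₃]

lemma shortExact_of_linearMaps {f : M₁ →ₗ[A] M₂} {g : M₂ →ₗ[A] M₃}
    (hf : Function.Injective f) (hfg : Function.Exact f g) (hg : Function.Surjective g) :
    (ShortComplex.moduleCatMk f g hfg.linearMap_comp_eq_zero).ShortExact :=
  ModuleCat.shortComplex_shortExact _ hfg hf hg

/-- Writing the identity of `M` as a sum of maps through the `N i` decomposes every class into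
pullbacks of classes in zero groups. This treats retracts, finite direct sums and `add T` at once.
-/
lemma ExtZero.of_sum_comp {J : Type*} [Fintype J] {N : J → Type u} [∀ i, AddCommGroup (N i)]
    [∀ i, Module A (N i)] (ι : ∀ i, N i →ₗ[A] M) (π : ∀ i, M →ₗ[A] N i)
    (h : ∑ i, ι i ∘ₗ π i = LinearMap.id) {k : ℕ} (hN : ∀ i, ExtZero A (N i) X k) :
    ExtZero A M X k := by
  refine subsingleton_of_forall_eq 0 fun x => ?_
  have hid : 𝟙 (ModuleCat.of A M) = ∑ i, ModuleCat.ofHom (π i) ≫ ModuleCat.ofHom (ι i) := by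
    ext1
    rw [ModuleCat.hom_sum]
    exact h.symm
  rw [← Ext.mk₀_id_comp x, hid, Ext.mk₀_sum, Ext.sum_comp]
  refine Finset.sum_eq_zero fun i _ => ?_
  rw [← Ext.mk₀_comp_mk₀_assoc, Subsingleton.elim (Ext.comp _ x _) 0, Ext.comp_zero]

lemma ExtZero.of_retract (s : M →ₗ[A] M₁) (r : M₁ →ₗ[A] M) (h : r ∘ₗ s = LinearMap.id) {k : ℕ}
    (hN : ExtZero A M₁ X k) : ExtZero A M X k :=
  ExtZero.of_sum_comp (J := Unit) (fun _ => r) (fun _ => s) (by simpa using h) fun _ => hN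

lemma ExtZero.of_equiv (e : M ≃ₗ[A] M₁) {k : ℕ} (hN : ExtZero A M₁ X k) : ExtZero A M X k :=
  ExtZero.of_retract e.toLinearMap e.symm.toLinearMap (by ext; simp) hN

lemma ExtZero.of_equiv_right (e : X ≃ₗ[A] X₁) {k : ℕ} (hN : ExtZero A M X₁ k) :
    ExtZero A M X k := by
  refine subsingleton_of_forall_eq 0 fun x => ?_
  have hid : 𝟙 (ModuleCat.of A X) =
      ModuleCat.ofHom e.toLinearMap ≫ ModuleCat.ofHom e.symm.toLinearMap := by
    ext; simp
  rw [← Ext.comp_mk₀_id x, hid, ← Ext.mk₀_comp_mk₀,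
    ← Ext.comp_assoc_of_second_deg_zero, Subsingleton.elim (Ext.comp x _ _) 0, Ext.zero_comp]

lemma extZero_of_subsingleton_left [Subsingleton M] (k : ℕ) : ExtZero A M X k :=
  ExtZero.of_sum_comp (J := Empty) (N := fun _ => PUnit) (fun _ => 0) (fun _ => 0)
    (by ext x; exact Subsingleton.elim _ _) (fun i => i.elim)

lemma extZero_of_subsingleton_right [Subsingleton X] (k : ℕ) : ExtZero A M X k := by
  refine subsingleton_of_forall_eq 0 fun x => ?_
  have hid : 𝟙 (ModuleCat.of A X) = 0 := by
    ext; exact Subsingleton.elim (α := X) _ _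
  rw [← Ext.comp_mk₀_id x, hid, Ext.mk₀_zero, Ext.comp_zero]

lemma extZero_of_projective [Module.Projective A M] (k : ℕ) : ExtZero A M X (k + 1) :=
  have : Projective (ModuleCat.of A M) := ModuleCat.projective_of_categoryTheory_projective _
  Ext.subsingleton_of_projective _ _ k

lemma extZero_zero_iff : ExtZero A M X 0 ↔ ∀ f : M →ₗ[A] X, f = 0 := by
  rw [ExtZero, (Ext.addEquiv₀.toEquiv.trans ModuleCat.homEquiv).subsingleton_congr]
  exact ⟨fun h f => Subsingleton.elim f 0, fun h => subsingleton_of_forall_eq 0 h⟩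

section

variable {f : M₁ →ₗ[A] M₂} {g : M₂ →ₗ[A] M₃} (hf : Function.Injective f)
  (hfg : Function.Exact f g) (hg : Function.Surjective g) {k : ℕ}
include hf hfg hg

lemma ExtZero.middle_left (h₁ : ExtZero A M₁ X k) (h₃ : ExtZero A M₃ X k) :
    ExtZero A M₂ X k := by
  refine subsingleton_of_forall_eq 0 fun x => ?_
  obtain ⟨y, rfl⟩ := Ext.contravariant_sequence_exact₂ (shortExact_of_linearMaps hf hfg hg) _ x
    (h₁.elim _ _)
  obtain rfl : y = 0 := h₃.elim _ _
  rw [Ext.comp_zero]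
  rfl

lemma ExtZero.sub_left (h₂ : ExtZero A M₂ X k) (h₃ : ExtZero A M₃ X (k + 1)) :
    ExtZero A M₁ X k := by
  refine subsingleton_of_forall_eq 0 fun x => ?_
  obtain ⟨y, rfl⟩ := Ext.contravariant_sequence_exact₁ (shortExact_of_linearMaps hf hfg hg) _ x
    (add_comm 1 k) (h₃.elim _ _)
  obtain rfl : y = 0 := h₂.elim _ _
  rw [Ext.comp_zero]
  rfl

lemma ExtZero.quot_left (h₁ : ExtZero A M₁ X k) (h₂ : ExtZero A M₂ X (k + 1)) :
    ExtZero A M₃ X (k + 1) := by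
  refine subsingleton_of_forall_eq 0 fun x => ?_
  obtain ⟨y, rfl⟩ := Ext.contravariant_sequence_exact₃ (shortExact_of_linearMaps hf hfg hg) _ x
    (h₂.elim _ _) (add_comm 1 k)
  obtain rfl : y = 0 := h₁.elim _ _
  rw [Ext.comp_zero]
  rfl

end

section

variable {f : X₁ →ₗ[A] X₂} {g : X₂ →ₗ[A] X₃} (hf : Function.Injective f)
  (hfg : Function.Exact f g) (hg : Function.Surjective g) {k : ℕ}
include hf hfg hg

lemma ExtZero.middle_right (h₁ : ExtZero A M X₁ k) (h₃ : ExtZero A M X₃ k) :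
    ExtZero A M X₂ k := by
  refine subsingleton_of_forall_eq 0 fun x => ?_
  obtain ⟨y, rfl⟩ := Ext.covariant_sequence_exact₂ _ (shortExact_of_linearMaps hf hfg hg) x
    (h₃.elim _ _)
  obtain rfl : y = 0 := h₁.elim _ _
  rw [Ext.zero_comp]
  rfl

lemma ExtZero.quot_right (h₂ : ExtZero A M X₂ k) (h₁ : ExtZero A M X₁ (k + 1)) :
    ExtZero A M X₃ k := by
  refine subsingleton_of_forall_eq 0 fun x => ?_
  obtain ⟨y, rfl⟩ := Ext.covariant_sequence_exact₃ _ (shortExact_of_linearMaps hf hfg hg) x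
    rfl (h₁.elim _ _)
  obtain rfl : y = 0 := h₂.elim _ _
  rw [Ext.zero_comp]
  rfl

lemma ExtZero.sub_right (h₃ : ExtZero A M X₃ k) (h₂ : ExtZero A M X₂ (k + 1)) :
    ExtZero A M X₁ (k + 1) := by
  refine subsingleton_of_forall_eq 0 fun x => ?_
  obtain ⟨y, rfl⟩ := Ext.covariant_sequence_exact₁ _ (shortExact_of_linearMaps hf hfg hg) x
    (h₂.elim _ _) rfl
  obtain rfl : y = 0 := h₃.elim _ _
  rw [Ext.zero_comp]
  rfl

end

/-- If `Ext¹(M₃, X) = 0`, homomorphisms `M₁ → X` extend along `M₁ → M₂`. -/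
lemma ExtZero.exists_extension {f : M₁ →ₗ[A] M₂} {g : M₂ →ₗ[A] M₃} (hf : Function.Injective f)
    (hfg : Function.Exact f g) (hg : Function.Surjective g) (h : ExtZero A M₃ X 1)
    (φ : M₁ →ₗ[A] X) : ∃ ψ : M₂ →ₗ[A] X, ψ ∘ₗ f = φ := by
  obtain ⟨y, hy⟩ := Ext.contravariant_sequence_exact₁ (shortExact_of_linearMaps hf hfg hg) _
    (Ext.mk₀ (ModuleCat.ofHom φ)) (add_zero 1) (h.elim _ _)
  obtain ⟨ψ, rfl⟩ := Ext.addEquiv₀.symm.surjective y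
  refine ⟨ψ.hom, ?_⟩
  have := Ext.addEquiv₀.symm.injective ((Ext.mk₀_comp_mk₀ _ _).symm.trans hy)
  exact congrArg ModuleCat.Hom.hom this

/-- As the middle term is projective, each class in `Ext¹` is the image of a homomorphism under the
connecting map, and this image vanishes once the homomorphism extends. -/
lemma subsingleton_ext_one_of_exists_extension {S : ShortComplex (ModuleCat.{u} A)}
    (hS : S.ShortExact) [Projective S.X₂] {Y : ModuleCat.{u} A}
    (h : ∀ φ : S.X₁ ⟶ Y, ∃ ψ : S.X₂ ⟶ Y, S.f ≫ ψ = φ) : Subsingleton (Ext.{u} S.X₃ Y 1) := by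
  refine subsingleton_of_forall_eq 0 fun x => ?_
  obtain ⟨y, rfl⟩ := Ext.contravariant_sequence_exact₃ hS _ x (Ext.eq_zero_of_projective _)
    (add_zero 1)
  obtain ⟨φ, rfl⟩ := Ext.addEquiv₀.symm.surjective y
  obtain ⟨ψ, rfl⟩ := h φ
  change hS.extClass.comp (Ext.mk₀ (S.f ≫ ψ)) _ = 0
  rw [← Ext.mk₀_comp_mk₀, ShortComplex.ShortExact.extClass_comp_assoc]

lemma extZero_one_of_exists_extension [Module.Projective A M₂] {f : M₁ →ₗ[A] M₂}
    {g : M₂ →ₗ[A] M₃} (hf : Function.Injective f)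
    (hfg : Function.Exact f g) (hg : Function.Surjective g)
    (h : ∀ φ : M₁ →ₗ[A] X, ∃ ψ : M₂ →ₗ[A] X, ψ ∘ₗ f = φ) : ExtZero A M₃ X 1 := by
  have : Projective (ShortComplex.moduleCatMk f g hfg.linearMap_comp_eq_zero).X₂ :=
    ModuleCat.projective_of_categoryTheory_projective (ModuleCat.of A M₂)
  refine subsingleton_ext_one_of_exists_extension (shortExact_of_linearMaps hf hfg hg)
    (Y := ModuleCat.of A X) fun φ => ?_
  obtain ⟨ψ, hψ⟩ := h φ.hom
  exact ⟨ModuleCat.ofHom ψ, ModuleCat.hom_ext hψ⟩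

lemma exact_subtype_mkQ (N : Submodule A M) : Function.Exact N.subtype N.mkQ := by
  rw [LinearMap.exact_iff]; simp

lemma submodule_exact_subtype {N : Submodule A M} {g : M →ₗ[A] M₃} (h : LinearMap.ker g = N) :
    Function.Exact N.subtype g := by
  rw [LinearMap.exact_iff, h]; simp

end ExtVanishing

/-! ### The indecomposable projectives are local, with pairwise distinct tops. -/

section LocalProjectives

variable {A : Type u} [Ring A] {n : ℕ} {e : Fin n → A} {i j : Fin n}
  {M N : Type u} [AddCommGroup M] [Module A M] [AddCommGroup N] [Module A N]

/-- The generator `eᵢ` of `P(i) = A eᵢ`. -/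
def gen (e : Fin n → A) (i : Fin n) : P e i :=
  ⟨e i, Submodule.mem_span_singleton_self _⟩

lemma P_mul_self (hi : IsIdempotentElem (e i)) (p : P e i) : (p : A) * e i = p := by
  obtain ⟨a, ha⟩ := Submodule.mem_span_singleton.1 p.2
  rw [← ha, smul_eq_mul, mul_assoc, hi.eq]

lemma P_smul_gen (hi : IsIdempotentElem (e i)) (p : P e i) : (p : A) • gen e i = p :=
  Subtype.ext (P_mul_self hi p)

/-- The homomorphism `P(i) → M` given by right multiplication with an element of `M`. -/
def homOfElement (e : Fin n → A) (i : Fin n) (m : M) : P e i →ₗ[A] M :=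
  (LinearMap.toSpanSingleton A M m).domRestrict (P e i)

lemma P_projective (hi : IsIdempotentElem (e i)) : Module.Projective A (P e i) :=
  Module.Projective.of_split (P e i).subtype (LinearMap.toSpanSingleton A _ (gen e i))
    (by ext p; exact P_mul_self hi p)

lemma gen_ne_zero (hi : e i ≠ 0) : gen e i ≠ 0 := fun h => hi (congrArg Subtype.val h)

lemma eq_top_of_gen_mem (hi : IsIdempotentElem (e i)) {U : Submodule A (P e i)}
    (h : gen e i ∈ U) : U = ⊤ :=
  eq_top_iff.2 fun p _ => P_smul_gen hi p ▸ U.smul_mem _ h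

/-- The components of `e i` in a decomposition of `P(i)` are orthogonal idempotents, so primitivity
kills one of them and with it the corresponding summand. -/
lemma P_eq_bot_of_isCompl (hi : IsPrimitiveIdempotent (e i)) {U V : Submodule A (P e i)}
    (h : IsCompl U V) : U = ⊥ ∨ V = ⊥ := by
  obtain ⟨u, hu, v, hv, huv⟩ := Submodule.mem_sup.1
    (h.sup_eq_top ▸ Submodule.mem_top : gen e i ∈ U ⊔ V)
  -- For `p ∈ U`, the identity `p = p * e i = p * u + p * v` places `p * v` in `U ∩ V = 0`.
  have key : ∀ {U V : Submodule A (P e i)} {u v : P e i}, Disjoint U V → u ∈ U → v ∈ V →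
      u + v = gen e i → ∀ p ∈ U, (p : A) • u = p ∧ (p : A) • v = 0 := by
    intro U V u v h hu hv huv p hp
    have h1 : (p : A) • u + (p : A) • v = p := by
      rw [← smul_add, huv, P_smul_gen hi.1]
    have h2 : (p : A) • v = 0 := by
      refine Submodule.disjoint_def.1 h _ ?_ (V.smul_mem _ hv)
      rw [eq_sub_of_add_eq' h1]
      exact U.sub_mem hp (U.smul_mem _ hu)
    exact ⟨by rwa [h2, add_zero] at h1, h2⟩
  have hU := key h.disjoint hu hv huv
  have hV := key h.symm.disjoint hv hu ((add_comm _ _).trans huv)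
  have c : ∀ {x y z : P e i}, (x : A) • y = z → (x : A) * y = z := fun h => congrArg Subtype.val h
  rcases hi.2.2 u v (c (hU u hu).1) (c (hV v hv).1) (c (hU u hu).2) (c (hV v hv).2)
    (congrArg Subtype.val huv.symm) with h0 | h0
  · refine Or.inl ((Submodule.eq_bot_iff _).2 fun p hp => ?_)
    rw [← (hU p hp).1, Subtype.ext (a1 := u) (a2 := 0) h0, smul_zero]
  · refine Or.inr ((Submodule.eq_bot_iff _).2 fun p hp => ?_)
    rw [← (hV p hp).1, Subtype.ext (a1 := v) (a2 := 0) h0, smul_zero]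

variable [IsArtinianRing A] [IsNoetherianRing A]

/-- Fitting's lemma together with indecomposability. The exponent `k + 1` is positive, so the kernel
of the power contains that of `f`. -/
lemma P_isNilpotent_of_not_surjective (hi : IsPrimitiveIdempotent (e i))
    (f : Module.End A (P e i)) (hf : ¬ Function.Surjective f) : IsNilpotent f := by
  obtain ⟨k, hk⟩ := Filter.eventually_atTop.1 f.eventually_isCompl_ker_pow_range_pow
  rcases P_eq_bot_of_isCompl hi (hk (k + 1) (Nat.le_succ k)) with h | h
  · refine absurd (IsArtinian.surjective_of_injective_endomorphism f ?_) hf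
    rw [← LinearMap.ker_eq_bot, eq_bot_iff, ← h, pow_succ]
    exact LinearMap.ker_le_ker_comp f _
  · exact ⟨k + 1, LinearMap.range_eq_bot.1 h⟩

/-- If `e i = u + v` with `u ∈ U` and `v ∈ V`, right multiplications by `u` and `v` add up to the
identity. The first is not surjective, hence nilpotent, so the second is invertible although its
image lies in `V`. -/
lemma P_sup_ne_top (hi : IsPrimitiveIdempotent (e i)) {U V : Submodule A (P e i)}
    (hU : U ≠ ⊤) (hV : V ≠ ⊤) : U ⊔ V ≠ ⊤ := by
  intro h
  obtain ⟨u, hu, v, hv, huv⟩ := Submodule.mem_sup.1 (h ▸ Submodule.mem_top : gen e i ∈ U ⊔ V)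
  have range_le : ∀ (W : Submodule A (P e i)) (w : P e i), w ∈ W → W ≠ ⊤ →
      ¬ Function.Surjective (homOfElement e i w) := fun W w hw hW hs => hW <| eq_top_iff.2 fun x _ => by
    obtain ⟨p, rfl⟩ := hs x
    exact W.smul_mem _ hw
  have hsum : homOfElement e i v = 1 - homOfElement e i u := by
    rw [eq_sub_iff_add_eq]
    ext p
    change (((p : A) • v + (p : A) • u : P e i) : A) = p
    rw [← smul_add, add_comm v u, huv, P_smul_gen hi.1]
  have hunit : IsUnit (homOfElement e i v : Module.End A (P e i)) := by
    rw [hsum]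
    exact (P_isNilpotent_of_not_surjective hi _ (range_le U u hu hU)).isUnit_one_sub
  exact range_le V v hv hV ((Module.End.isUnit_iff _).1 hunit).2

lemma P_jacobson (hi : IsPrimitiveIdempotent (e i)) :
    IsCoatom (Module.jacobson A (P e i)) ∧
      ∀ U : Submodule A (P e i), U ≠ ⊤ → U ≤ Module.jacobson A (P e i) := by
  have : Nontrivial (P e i) := ⟨gen e i, 0, gen_ne_zero hi.2.1⟩
  obtain ⟨m, hm, -⟩ := (eq_top_or_exists_le_coatom (⊥ : Submodule A (P e i))).resolve_left
    bot_ne_top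
  have key : ∀ U : Submodule A (P e i), U ≠ ⊤ → U ≤ m := fun U hU =>
    le_sup_left.trans (hm.le_iff_eq (P_sup_ne_top hi hU hm.1) |>.1 le_sup_right).le
  have hJ : Module.jacobson A (P e i) = m :=
    le_antisymm (sInf_le hm) (le_sInf fun m' hm' => (hm'.le_iff_eq hm.1).1 (key m' hm'.1) ▸ le_rfl)
  rw [hJ]
  exact ⟨hm, key⟩

lemma E_isSimple (hi : IsPrimitiveIdempotent (e i)) : IsSimpleModule A (E e i) :=
  isSimpleModule_iff_isCoatom.2 (P_jacobson hi).1

lemma gen_not_mem_jacobson (hi : IsPrimitiveIdempotent (e i)) :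
    gen e i ∉ Module.jacobson A (P e i) :=
  fun h => (P_jacobson hi).1.1 (eq_top_of_gen_mem hi.1 h)

lemma exists_smul_ne_zero_E (hi : IsPrimitiveIdempotent (e i)) : ∃ x : E e i, e i • x ≠ 0 := by
  refine ⟨Submodule.Quotient.mk (gen e i), ?_⟩
  rw [← Submodule.Quotient.mk_smul, ne_eq, Submodule.Quotient.mk_eq_zero]
  convert gen_not_mem_jacobson hi using 2
  exact P_smul_gen hi.1 (gen e i)

/-- A simple module `S` with `eᵢ S ≠ 0` is isomorphic to `E(i)`. -/
lemma nonempty_equiv_E (hi : IsPrimitiveIdempotent (e i)) [IsSimpleModule A M] {x : M}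
    (hx : e i • x ≠ 0) : Nonempty (M ≃ₗ[A] E e i) := by
  have hf : homOfElement e i x ≠ 0 := fun h => hx (LinearMap.congr_fun h (gen e i))
  have hs := LinearMap.surjective_of_ne_zero hf
  have equiv := (homOfElement e i x).quotKerEquivOfSurjective hs
  have hc : IsCoatom (LinearMap.ker (homOfElement e i x)) :=
    isSimpleModule_iff_isCoatom.1 (IsSimpleModule.congr equiv)
  have : LinearMap.ker (homOfElement e i x) = Module.jacobson A (P e i) :=
    ((hc.le_iff_eq (P_jacobson hi).1.1).1 ((P_jacobson hi).2 _ hc.1)).symm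
  exact ⟨equiv.symm.trans (Submodule.quotEquivOfEq _ _ this)⟩

/-- A surjection `P(i) → S` onto a simple module lifts along any other nonzero
`P(j) → S` to a surjection. -/
lemma exists_surjective_hom (hi : IsPrimitiveIdempotent (e i)) (hj : IsPrimitiveIdempotent (e j))
    [IsSimpleModule A M] {x y : M} (hx : e i • x ≠ 0) (hy : e j • y ≠ 0) :
    ∃ f : P e i →ₗ[A] P e j, Function.Surjective f := by
  have hf : homOfElement e i x ≠ 0 := fun h => hx (LinearMap.congr_fun h (gen e i))
  have hg : homOfElement e j y ≠ 0 := fun h => hy (LinearMap.congr_fun h (gen e j))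
  have := P_projective hi.1
  obtain ⟨h, hh⟩ := Module.projective_lifting_property (homOfElement e j y) (homOfElement e i x)
    (LinearMap.surjective_of_ne_zero hg)
  refine ⟨h, LinearMap.range_eq_top.1 (by_contra fun hne => hf ?_)⟩
  rw [← hh]
  have hker : LinearMap.ker (homOfElement e j y) ≠ ⊤ := fun h => hg (LinearMap.ker_eq_top.1 h)
  have h1 := (P_jacobson hj).2 _ hne
  have h2 : LinearMap.ker (homOfElement e j y) = Module.jacobson A (P e j) := by
    have hc : IsCoatom (LinearMap.ker (homOfElement e j y)) :=
      isSimpleModule_iff_isCoatom.1 (IsSimpleModule.congr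
        ((homOfElement e j y).quotKerEquivOfSurjective (LinearMap.surjective_of_ne_zero hg)))
    exact ((hc.le_iff_eq (P_jacobson hj).1.1).1 ((P_jacobson hj).2 _ hc.1)).symm
  ext p
  exact (h2 ▸ h1 : LinearMap.range h ≤ LinearMap.ker (homOfElement e j y)) ⟨_, rfl⟩

/-- Two projective covers of one simple module surject onto each other. The composite is a
surjective endomorphism of a Noetherian module, hence injective, and basicness applies. -/
lemma eq_of_smul_ne_zero (he : IsBasicIdempotentSystem e) [IsSimpleModule A M] {x y : M}
    (hx : e i • x ≠ 0) (hy : e j • y ≠ 0) : i = j := by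
  obtain ⟨f, hf⟩ := exists_surjective_hom (he.primitive i) (he.primitive j) hx hy
  obtain ⟨g, hg⟩ := exists_surjective_hom (he.primitive j) (he.primitive i) hy hx
  have hinj : Function.Injective (g ∘ₗ f) :=
    IsNoetherian.injective_of_surjective_endomorphism (g ∘ₗ f) (hg.comp hf)
  exact he.basic i j ⟨LinearEquiv.ofBijective f ⟨Function.Injective.of_comp hinj, hf⟩⟩

omit [IsArtinianRing A] [IsNoetherianRing A] in
lemma sum_smul (he : IsBasicIdempotentSystem e) (x : M) : ∑ i, e i • x = x := by
  rw [← Finset.sum_smul, he.complete.complete, one_smul]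

omit [IsArtinianRing A] [IsNoetherianRing A] in
lemma exists_smul_not_mem (he : IsBasicIdempotentSystem e) {U : Submodule A M} {x : M}
    (hx : x ∉ U) : ∃ i, e i • x ∉ U := by
  by_contra! h
  exact hx (sum_smul he x ▸ U.sum_mem fun i _ => h i)

end LocalProjectives

/-! ### Composition multiplicities expressed through the idempotents. -/

section Multiplicities

variable {A : Type u} [Ring A] [IsArtinianRing A] [IsNoetherianRing A] {n : ℕ} {e : Fin n → A}
  {i j : Fin n} {M N : Type u} [AddCommGroup M] [Module A M] [AddCommGroup N] [Module A N]

lemma nonempty_factor_equiv_iff (hj : IsPrimitiveIdempotent (e j)) {U V : Submodule A M}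
    (h : U ⋖ V) : Nonempty ((V ⧸ U.submoduleOf V) ≃ₗ[A] E e j) ↔ ∃ x ∈ V, e j • x ∉ U := by
  have hs : IsSimpleModule A (V ⧸ U.submoduleOf V) := (covBy_iff_quot_is_simple h.le).1 h
  constructor
  · rintro ⟨φ⟩
    obtain ⟨x, hx⟩ := exists_smul_ne_zero_E hj
    obtain ⟨y, hy⟩ := Submodule.Quotient.mk_surjective _ (φ.symm x)
    refine ⟨y, y.2, fun h0 => hx ?_⟩
    have : e j • (Submodule.Quotient.mk y : V ⧸ U.submoduleOf V) = 0 := by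
      rw [← Submodule.Quotient.mk_smul, Submodule.Quotient.mk_eq_zero]
      exact h0
    rw [hy, ← map_smul] at this
    exact φ.symm.map_eq_zero_iff.1 this
  · rintro ⟨x, hx, h0⟩
    refine nonempty_equiv_E hj (x := Submodule.Quotient.mk ⟨x, hx⟩) ?_
    rwa [← Submodule.Quotient.mk_smul, ne_eq, Submodule.Quotient.mk_eq_zero]

lemma hasMultiplicity_iff_of_series (hj : IsPrimitiveIdempotent (e j)) {k : ℕ} :
    HasMultiplicity (A := A) (E e j) M k ↔
    ∃ s : CompositionSeries (Submodule A M), s.head = ⊥ ∧ s.last = ⊤ ∧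
      {i : Fin s.length | ∃ x ∈ s i.succ, e j • x ∉ s i.castSucc}.ncard = k := by
  unfold HasMultiplicity
  simp only [fun s : CompositionSeries (Submodule A M) => fun i : Fin s.length =>
    nonempty_factor_equiv_iff hj (s.step i)]

lemma hasMultiplicity_zero_iff (hj : IsPrimitiveIdempotent (e j)) [Module.Finite A M] :
    HasMultiplicity (A := A) (E e j) M 0 ↔ ∀ x : M, e j • x = 0 := by
  rw [hasMultiplicity_iff_of_series hj]
  constructor
  · rintro ⟨s, h0, h1, hs⟩ x
    rw [Set.ncard_eq_zero, Set.eq_empty_iff_forall_notMem] at hs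
    -- `e j` moves each term of the series into the preceding one; since `e j` is idempotent, the
    -- descent reaches zero.
    have key : ∀ (k : ℕ) (hk : k < s.length + 1), ∀ x ∈ s ⟨k, hk⟩, e j • x = 0 := by
      intro k
      induction k with
      | zero =>
        intro hk x hx
        have : x ∈ s.head := hx
        rw [h0, Submodule.mem_bot] at this
        rw [this, smul_zero]
      | succ k ih =>
        intro hk x hx
        have := hs ⟨k, by omega⟩
        simp only [Set.mem_ofPred_eq, not_exists, not_and, not_not] at this
        have h2 := ih (by omega) _ (this x hx)
        rwa [smul_smul, hj.1.eq] at h2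
    refine key s.length (by omega) x ?_
    have : x ∈ s.last := h1 ▸ Submodule.mem_top
    exact this
  · intro h
    obtain ⟨s, h0, h1⟩ := exists_compositionSeries_of_isNoetherian_isArtinian A M
    refine ⟨s, h0, h1, ?_⟩
    rw [Set.ncard_eq_zero, Set.eq_empty_iff_forall_notMem]
    rintro i ⟨x, -, hx⟩
    exact hx (h x ▸ Submodule.zero_mem _)

/-- Every composition series begins with the socle `S`, which is a copy of `E(j)`. Multiplicity one
therefore means that no factor above `S` is `E(j)`, that is, `e j` kills the quotient by `S`. -/
lemma hasMultiplicity_one_iff (hj : IsPrimitiveIdempotent (e j)) [Module.Finite A M]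
    {S : Submodule A M} (hS : IsSimpleModule A S) (hjS : ∃ x ∈ S, e j • x ≠ 0)
    (hess : ∀ U : Submodule A M, U ≠ ⊥ → S ≤ U) :
    HasMultiplicity (A := A) (E e j) M 1 ↔ ∀ x : M, e j • x ∈ S := by
  have hatom : IsAtom S := isSimpleModule_iff_isAtom.1 hS
  have htop : (⊤ : Submodule A M) ≠ ⊥ := fun h => hatom.1 (eq_bot_iff.2 (h ▸ le_top))
  have hlen : ∀ s : CompositionSeries (Submodule A M), s.head = ⊥ → s.last = ⊤ →
      0 < s.length := by
    intro s h0 h1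
    by_contra! hl
    refine htop (h1.symm.trans (Eq.trans (congrArg s.toFun (Fin.ext ?_)) h0))
    simpa using hl
  have hfirst : ∀ (s : CompositionSeries (Submodule A M)) (h0 : s.head = ⊥)
      (hl : 0 < s.length), s (Fin.succ ⟨0, hl⟩) = S := by
    intro s h0 hl
    have h2 := s.step ⟨0, hl⟩
    have h3 : s (Fin.castSucc ⟨0, hl⟩) = ⊥ := h0
    have h4 : (⊥ : Submodule A M) ⋖ s (Fin.succ ⟨0, hl⟩) := h3 ▸ h2
    rw [bot_covBy_iff] at h4
    exact ((h4.le_iff_eq hatom.1).1 (hess _ h4.1)).symm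
  rw [hasMultiplicity_iff_of_series hj]
  constructor
  · rintro ⟨s, h0, h1, hs⟩ x
    have hl := hlen s h0 h1
    obtain ⟨a, ha⟩ := Set.ncard_eq_one.1 hs
    have hz : (⟨0, hl⟩ : Fin s.length) ∈ {i : Fin s.length | ∃ x ∈ s i.succ, e j • x ∉ s i.castSucc} := by
      obtain ⟨y, hy, hy0⟩ := hjS
      refine ⟨y, (hfirst s h0 hl).symm ▸ hy, ?_⟩
      rw [show s (Fin.castSucc ⟨0, hl⟩) = ⊥ from h0]
      exact hy0
    rw [ha, Set.mem_singleton_iff] at hz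
    have key : ∀ (k : ℕ) (hk : k + 1 < s.length + 1), ∀ x ∈ s ⟨k + 1, hk⟩, e j • x ∈ S := by
      intro k
      induction k with
      | zero =>
        intro hk x hx
        rw [← hfirst s h0 hl]
        exact Submodule.smul_mem _ _ hx
      | succ k ih =>
        intro hk x hx
        have hn : (⟨k + 1, by omega⟩ : Fin s.length) ∉
            {i : Fin s.length | ∃ x ∈ s i.succ, e j • x ∉ s i.castSucc} := by
          rw [ha, Set.mem_singleton_iff, ← hz]
          simp
        simp only [Set.mem_ofPred_eq, not_exists, not_and, not_not] at hn
        have h2 := ih (by omega) _ (hn x hx)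
        rwa [smul_smul, hj.1.eq] at h2
    refine key (s.length - 1) (by omega) x ?_
    have hx : x ∈ s.last := h1 ▸ Submodule.mem_top
    convert hx using 2
    exact congrArg s.toFun (Fin.ext (by simp; omega))
  · intro h
    obtain ⟨s, h0, h1⟩ := exists_compositionSeries_of_isNoetherian_isArtinian A M
    have hl := hlen s h0 h1
    refine ⟨s, h0, h1, Set.ncard_eq_one.2 ⟨⟨0, hl⟩, Set.ext fun i => ?_⟩⟩
    rw [Set.mem_singleton_iff]
    constructor
    · rintro ⟨x, -, hx⟩
      by_contra hne
      have hi : (i : ℕ) ≠ 0 := fun h => hne (Fin.ext h)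
      have hle : s (Fin.succ ⟨0, hl⟩) ≤ s i.castSucc := by
        refine s.strictMono.monotone ?_
        rw [Fin.le_iff_val_le_val]
        simp only [Fin.val_succ, Fin.val_castSucc]
        omega
      exact hx (hle ((hfirst s h0 hl).symm ▸ h x))
    · rintro rfl
      obtain ⟨y, hy, hy0⟩ := hjS
      refine ⟨y, (hfirst s h0 hl).symm ▸ hy, ?_⟩
      rw [show s (Fin.castSucc ⟨0, hl⟩) = ⊥ from h0]
      exact hy0

end Multiplicities

/-! ### Finitely generated injective envelopes over an Artin algebra. -/

section InjectiveEnvelopes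

variable {A : Type u} [Ring A] {J : Type u} [AddCommGroup J] [Module A J]

lemma exists_maximal_essential_extension (S : Submodule A J) :
    ∃ E : Submodule A J, Maximal (fun E => S ≤ E ∧ ∀ N ≤ E, N ⊓ S = ⊥ → N = ⊥) E := by
  suffices h : ∃ E, S ≤ E ∧ Maximal (· ∈
      {E : Submodule A J | S ≤ E ∧ ∀ N ≤ E, N ⊓ S = ⊥ → N = ⊥}) E from
    h.imp fun _ hE => hE.2
  refine zorn_le_nonempty₀ _ (fun c hc hchain y hy => ?_) S
    ⟨le_rfl, fun N hN h => by rwa [inf_eq_left.2 hN] at h⟩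
  · refine ⟨sSup c, ⟨(hc hy).1.trans (le_sSup hy), fun N hN hNS => ?_⟩, fun z hz => le_sSup hz⟩
    refine (Submodule.eq_bot_iff _).2 fun x hx => ?_
    obtain ⟨E, hE, hxE⟩ := (Submodule.mem_sSup_of_directed ⟨y, hy⟩ hchain.directedOn).1 (hN hx)
    refine Submodule.span_singleton_eq_bot.1 ((hc hE).2 (Submodule.span A {x}) ?_ ?_)
    · rwa [Submodule.span_singleton_le_iff_mem]
    · refine eq_bot_iff.2 (le_trans (inf_le_inf_right S ?_) hNS.le)
      rwa [Submodule.span_singleton_le_iff_mem]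

lemma exists_maximal_disjoint (E : Submodule A J) :
    ∃ N : Submodule A J, Maximal (fun N => Disjoint E N) N := by
  obtain ⟨N, -, hN⟩ := zorn_le_nonempty₀ {N : Submodule A J | Disjoint E N}
    (fun c hc hchain y hy => ⟨sSup c, hchain.directedOn.disjoint_sSup_right.2 fun {b} hb => hc hb,
      fun z hz => le_sSup hz⟩) ⊥ disjoint_bot_right
  exact ⟨N, hN⟩

lemma injective_of_retract {I : Type u} [AddCommGroup I] [Module A I] [Module.Injective A J]
    (s : I →ₗ[A] J) (r : J →ₗ[A] I) (h : r ∘ₗ s = LinearMap.id) : Module.Injective A I where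
  out X Y _ _ _ _ f hf g := by
    obtain ⟨φ, hφ⟩ := Module.Injective.out f hf (s ∘ₗ g)
    exact ⟨r ∘ₗ φ, fun x => by
      rw [LinearMap.comp_apply, hφ]; exact LinearMap.congr_fun h (g x)⟩

/-- A maximal essential extension inside an injective module is injective. -/
lemma injective_of_maximal_essential [Module.Injective A J] {S E : Submodule A J}
    (hE : Maximal (fun E => S ≤ E ∧ ∀ N ≤ E, N ⊓ S = ⊥ → N = ⊥) E) : Module.Injective A E := by
  obtain ⟨N, hN⟩ := exists_maximal_disjoint E
  have hφ : Function.Injective (N.mkQ ∘ₗ E.subtype) := by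
    rw [← LinearMap.ker_eq_bot, LinearMap.ker_eq_bot']
    rintro ⟨x, hx⟩ h
    have : x ∈ N := (Submodule.Quotient.mk_eq_zero N).1 h
    exact Subtype.ext (Submodule.disjoint_def.1 hN.prop x hx this)
  obtain ⟨g, hg⟩ := Module.Injective.out _ hφ E.subtype
  have hgE : ∀ x ∈ E, g (N.mkQ x) = x := fun x hx => hg ⟨x, hx⟩
  -- The preimage of `U` contains `N`. It meets `E` trivially, because the composite is the identity
  -- on `E` and `E` is essential over `S`. Maximality of `N` gives equality.
  have key : ∀ U : Submodule A J, U ⊓ S = ⊥ → U.comap (g ∘ₗ N.mkQ) = N := by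
    intro U hU
    refine (hN.eq_of_le ?_ ?_).symm
    · refine Submodule.disjoint_def.2 fun x hxE hx => ?_
      have hxU : x ∈ U := hgE x hxE ▸ hx
      have := hE.prop.2 (U ⊓ E) inf_le_right
        (eq_bot_iff.2 ((inf_le_inf_right S inf_le_left).trans hU.le))
      exact (Submodule.mem_bot A).1 (this ▸ ⟨hxU, hxE⟩ : x ∈ (⊥ : Submodule A J))
    · intro x hx
      rw [Submodule.mem_comap, LinearMap.comp_apply, Submodule.mkQ_apply,
        (Submodule.Quotient.mk_eq_zero N).2 hx, map_zero]
      exact U.zero_mem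
  -- By `key`, the image of `g` is again essential over `S`; maximality of `E` turns `g` into a
  -- retraction of `J` onto `E`.
  have hrange : E = LinearMap.range g := by
    refine hE.eq_of_le ⟨fun x hx => ⟨N.mkQ x, hgE x (hE.prop.1 hx)⟩, fun U hU hUS => ?_⟩
      fun x hx => ⟨N.mkQ x, hgE x hx⟩
    refine (Submodule.eq_bot_iff _).2 fun x hx => ?_
    obtain ⟨y, rfl⟩ := hU hx
    obtain ⟨z, rfl⟩ := N.mkQ_surjective y
    have hz : z ∈ N := key U hUS ▸ hx
    rw [Submodule.mkQ_apply, (Submodule.Quotient.mk_eq_zero N).2 hz, map_zero]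
  refine injective_of_retract E.subtype
    ((g ∘ₗ N.mkQ).codRestrict E fun x => hrange.symm ▸ ⟨N.mkQ x, rfl⟩) ?_
  ext x
  exact hgE x x.2

variable {R : Type v} [CommRing R] [Algebra R A]

/-- Homomorphism groups of finitely generated modules are Noetherian over `R`. -/
lemma isNoetherian_hom_of_finite [IsNoetherianRing R] [Module.Finite R A]
    {K X : Type u} [AddCommGroup K] [Module A K] [AddCommGroup X] [Module A X] [Module R X]
    [IsScalarTower R A X] [SMulCommClass A R X] [Module.Finite A K] [Module.Finite A X] :
    IsNoetherian R (K →ₗ[A] X) := by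
  obtain ⟨s, hs⟩ := Module.Finite.fg_top (R := A) (M := K)
  have : Module.Finite R X := Module.Finite.trans A X
  let ev : (K →ₗ[A] X) →ₗ[R] (s → X) :=
    { toFun := fun f x => f x
      map_add' := fun _ _ => rfl
      map_smul' := fun _ _ => rfl }
  refine isNoetherian_of_injective ev fun f g h => LinearMap.ext_on hs fun x hx => ?_
  exact congrFun h ⟨x, hx⟩

/-- Induction on the length of `M` by left exactness of `Hom(-, I)`. On a simple module a nonzero
map has simple image, which lies in `S` by essentiality, so evaluation at a nonzero element embeds
the Hom group into `S`, a Noetherian `R`-module. -/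
lemma isNoetherian_hom_of_essential_simple [IsNoetherianRing R] [Module.Finite R A]
    {I : Type u} [AddCommGroup I] [Module A I] [Module R I] [IsScalarTower R A I]
    [SMulCommClass A R I] {S : Submodule A I} [IsSimpleModule A S]
    (hess : ∀ N : Submodule A I, N ⊓ S = ⊥ → N = ⊥)
    {M : Type u} [AddCommGroup M] [Module A M] (hM : IsFiniteLength A M) :
    IsNoetherian R (M →ₗ[A] I) := by
  induction hM with
  | @of_subsingleton M _ _ _ =>
    have : Subsingleton (M →ₗ[A] I) := ⟨fun f g => LinearMap.ext fun x => by
      rw [Subsingleton.elim x 0, map_zero, map_zero]⟩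
    infer_instance
  | @of_simple_quotient M _ _ N _ _ ih =>
    have hS : IsNoetherian R (S.restrictScalars R) := by
      have : Module.Finite R S := Module.Finite.trans A S
      exact isNoetherian_of_isNoetherianRing_of_finite R S
    have hquot : IsNoetherian R ((M ⧸ N) →ₗ[A] I) := by
      have := IsSimpleModule.nontrivial A (M ⧸ N)
      obtain ⟨x, hx⟩ := exists_ne (0 : M ⧸ N)
      let ev : ((M ⧸ N) →ₗ[A] I) →ₗ[R] I :=
        { toFun := fun f => f x
          map_add' := fun _ _ => rfl
          map_smul' := fun _ _ => rfl }
      have hev : ∀ f, ev f ∈ S.restrictScalars R := by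
        intro f
        rcases eq_or_ne (LinearMap.range f) ⊥ with h | h
        · have : f x = 0 := (Submodule.mem_bot A).1 (h ▸ ⟨x, rfl⟩)
          exact this ▸ S.zero_mem
        · have hf : f ≠ 0 := fun h0 => h (LinearMap.range_eq_bot.2 h0)
          have hatom : IsAtom (LinearMap.range f) := isSimpleModule_iff_isAtom.1
            (IsSimpleModule.congr
              (LinearEquiv.ofInjective f (LinearMap.injective_of_ne_zero hf)).symm)
          have h1 : LinearMap.range f ⊓ S ≠ ⊥ := fun h0 => h (hess _ h0)
          exact inf_eq_left.1 ((hatom.le_iff_eq h1).1 inf_le_left) ⟨x, rfl⟩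
      refine isNoetherian_of_injective (ev.codRestrict _ hev) fun f g h => ?_
      have h2 : f x = g x := congrArg Subtype.val h
      ext1
      ext y
      obtain ⟨a, ha⟩ := IsSimpleModule.toSpanSingleton_surjective A hx (Submodule.Quotient.mk y)
      change f (Submodule.Quotient.mk y) = g (Submodule.Quotient.mk y)
      rw [← ha, LinearMap.toSpanSingleton_apply, map_smul, map_smul, h2]
    let res : (M →ₗ[A] I) →ₗ[R] (N →ₗ[A] I) :=
      { toFun := fun f => f ∘ₗ N.subtype
        map_add' := fun _ _ => rfl
        map_smul' := fun _ _ => rfl }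
    let inf : ((M ⧸ N) →ₗ[A] I) →ₗ[R] (M →ₗ[A] I) :=
      { toFun := fun f => f ∘ₗ N.mkQ
        map_add' := fun _ _ => rfl
        map_smul' := fun _ _ => rfl }
    refine isNoetherian_of_range_eq_ker inf res (le_antisymm ?_ ?_)
    · rintro _ ⟨f, rfl⟩
      refine LinearMap.mem_ker.2 (LinearMap.ext fun x => ?_)
      change f (N.mkQ x) = 0
      rw [Submodule.mkQ_apply, (Submodule.Quotient.mk_eq_zero N).2 x.2, map_zero]
    · intro f hf
      have hN : N ≤ LinearMap.ker f := fun x hx => LinearMap.congr_fun hf ⟨x, hx⟩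
      exact ⟨N.liftQ f hN, N.liftQ_mkQ f hN⟩

/-- Over an Artin algebra, simple modules have finitely generated injective envelopes. -/
theorem exists_isInjectiveEnvelope (R : Type v) [CommRing R] [IsArtinianRing R] [Algebra R A]
    [Module.Finite R A] (S : Type u) [AddCommGroup S] [Module A S] [IsSimpleModule A S] :
    ∃ I : ModuleCat.{u} A, IsInjectiveEnvelope (A := A) S I := by
  have : IsArtinianRing A := IsArtinianRing.of_finite R A
  have : IsNoetherianRing A := isNoetherian_of_tower R inferInstance
  let J := Injective.under (ModuleCat.of A S)
  let ι : S →ₗ[A] J := (Injective.ι (ModuleCat.of A S)).hom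
  have hι : Function.Injective ι :=
    (ModuleCat.mono_iff_injective (Injective.ι (ModuleCat.of A S))).1 inferInstance
  have hJ : Module.Injective A J := by
    have : Injective (ModuleCat.of A J) :=
      inferInstanceAs (Injective (Injective.under (ModuleCat.of A S)))
    exact Module.injective_module_of_injective_object A J
  obtain ⟨E, hE⟩ := exists_maximal_essential_extension (LinearMap.range ι)
  let φ : S →ₗ[A] E := ι.codRestrict E fun x => hE.prop.1 ⟨x, rfl⟩
  have hφ : Function.Injective φ := fun x y h => hι (congrArg Subtype.val h)
  have hess : ∀ N : Submodule A E, N ⊓ LinearMap.range φ = ⊥ → N = ⊥ := by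
    intro N hN
    have h1 := hE.prop.2 (N.map E.subtype) (Submodule.map_subtype_le E N) (by
      refine (Submodule.eq_bot_iff _).2 ?_
      rintro _ ⟨⟨x, hx, rfl⟩, ⟨y, hy⟩⟩
      have : x ∈ N ⊓ LinearMap.range φ := ⟨hx, y, Subtype.ext hy⟩
      rw [hN, Submodule.mem_bot] at this
      rw [this, map_zero])
    exact Submodule.map_injective_of_injective E.subtype_injective (h1.trans (Submodule.map_bot _).symm)
  have hsimple : IsSimpleModule A (LinearMap.range φ) :=
    IsSimpleModule.congr (LinearEquiv.ofInjective φ hφ).symm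
  let modR : Module R E := Module.compHom E (algebraMap R A)
  have tower : IsScalarTower R A E := ⟨fun r a x => by
    change (r • a) • x = algebraMap R A r • a • x
    rw [smul_smul, Algebra.smul_def]⟩
  have comm : SMulCommClass A R E := ⟨fun a r x => by
    change a • algebraMap R A r • x = algebraMap R A r • a • x
    rw [smul_smul, smul_smul, Algebra.commutes]⟩
  have hfin : IsFiniteLength A A := isFiniteLength_iff_isNoetherian_isArtinian.2
    ⟨inferInstance, inferInstance⟩
  -- Applied to the regular module, this bounds `E` itself, since evaluation at `1` maps `Hom(A, E)`
  -- onto `E`.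
  have := isNoetherian_hom_of_essential_simple (R := R) hess hfin
  let ev : (A →ₗ[A] E) →ₗ[R] E :=
    { toFun := fun f => f 1
      map_add' := fun _ _ => rfl
      map_smul' := fun _ _ => rfl }
  have hfinR : Module.Finite R E := Module.Finite.of_surjective ev fun x =>
    ⟨LinearMap.toSpanSingleton A E x, one_smul A x⟩
  exact ⟨ModuleCat.of A E, Module.Finite.of_restrictScalars_finite R A E,
    injective_of_maximal_essential hE, φ, hφ, hess⟩

end InjectiveEnvelopes

/-! ### Inductive filtrations and their closure properties. -/

section Filtrations

variable {A : Type u} [Ring A]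

/-- `Θ`-filtered modules, built from `0` by successive extensions by members of `Θ`. -/
inductive Fil (Θ : ObjectProperty (ModuleCat.{u} A)) :
    (M : Type u) → [AddCommGroup M] → [Module A M] → Prop
  | of_subsingleton {M : Type u} [AddCommGroup M] [Module A M] [Subsingleton M] : Fil Θ M
  | step {M : Type u} [AddCommGroup M] [Module A M] {N : Submodule A M}
      (hN : Fil Θ N) (hQ : Θ (ModuleCat.of A (M ⧸ N))) : Fil Θ M

/-- Closure of a class of modules under isomorphisms. -/
def IsoClosed (Θ : ObjectProperty (ModuleCat.{u} A)) : Prop :=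
  ∀ M N : ModuleCat.{u} A, (M ≃ₗ[A] N) → Θ M → Θ N

variable {Θ : ObjectProperty (ModuleCat.{u} A)} {M M₁ M₂ M₃ : Type u}
  [AddCommGroup M] [Module A M]
  [AddCommGroup M₁] [Module A M₁] [AddCommGroup M₂] [Module A M₂] [AddCommGroup M₃] [Module A M₃]

lemma ker_mkQ_comp_eq_comap (g : M₂ →ₗ[A] M₃) (N : Submodule A M₃) :
    LinearMap.ker (N.mkQ ∘ₗ g) = N.comap g := by
  rw [LinearMap.ker_comp, Submodule.ker_mkQ]

/-- `M₂ / g⁻¹(N) ≃ M₃ / N` for surjective `g`. -/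
noncomputable def quotComapEquiv {g : M₂ →ₗ[A] M₃} (hg : Function.Surjective g)
    (N : Submodule A M₃) : (M₂ ⧸ N.comap g) ≃ₗ[A] M₃ ⧸ N :=
  (Submodule.quotEquivOfEq _ _ (ker_mkQ_comp_eq_comap g N).symm).trans
    ((N.mkQ ∘ₗ g).quotKerEquivOfSurjective (N.mkQ_surjective.comp hg))

/-- The factor `V / U` of two submodules, as the image of a map with kernel `U`. -/
noncomputable def factorEquiv {U V : Submodule A M} (g : V →ₗ[A] M₁)
    (hker : LinearMap.ker g = U.submoduleOf V) (hg : Function.Surjective g) :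
    (V ⧸ U.submoduleOf V) ≃ₗ[A] M₁ :=
  (Submodule.quotEquivOfEq _ _ hker.symm).trans (g.quotKerEquivOfSurjective hg)

lemma Fil.equiv (hΘ : IsoClosed Θ) (h : Fil Θ M₁) (φ : M₁ ≃ₗ[A] M₂) : Fil Θ M₂ := by
  induction h generalizing M₂ with
  | of_subsingleton =>
    have := φ.symm.toEquiv.subsingleton
    exact .of_subsingleton
  | @step M _ _ N hN hQ ih =>
    exact .step (N := N.comap φ.symm.toLinearMap) (ih (φ.symm.ofSubmodule' N).symm)
      (hΘ _ _ (quotComapEquiv (g := φ.symm.toLinearMap) φ.symm.surjective N).symm hQ)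

lemma Fil.of_mem (hΘ : IsoClosed Θ) (h : Θ (ModuleCat.of A M)) : Fil Θ M :=
  .step (N := ⊥) .of_subsingleton (hΘ _ _ (Submodule.quotEquivOfEqBot _ rfl).symm h)

/-- A filtration of `M₃` pulls back along `g`: each inverse image is again an extension by `M₁` and
has the same top factor. -/
lemma Fil.ext (hΘ : IsoClosed Θ) {f : M₁ →ₗ[A] M₂} {g : M₂ →ₗ[A] M₃}
    (hf : Function.Injective f) (hfg : Function.Exact f g) (hg : Function.Surjective g)
    (h₁ : Fil Θ M₁) (h₃ : Fil Θ M₃) : Fil Θ M₂ := by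
  induction h₃ generalizing M₂ with
  | of_subsingleton =>
    refine h₁.equiv hΘ (LinearEquiv.ofBijective f ⟨hf, fun x => ?_⟩)
    exact (hfg x).1 (Subsingleton.elim _ _)
  | @step M _ _ N hN hQ ih =>
    have hmem : ∀ x, f x ∈ N.comap g := fun x => by
      rw [Submodule.mem_comap, hfg.apply_apply_eq_zero]; exact N.zero_mem
    refine .step (N := N.comap g) (ih (f := f.codRestrict _ hmem)
      (g := g.restrict (p := N.comap g) (q := N) fun x hx => hx) ?_ ?_ ?_)
      (hΘ _ _ (quotComapEquiv hg N).symm hQ)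
    · exact fun x y h => hf (congrArg Subtype.val h)
    · rintro ⟨x, hx⟩
      have := hfg x
      simp only [Set.mem_range, Subtype.ext_iff, LinearMap.coe_restrict_apply,
        ZeroMemClass.coe_zero, LinearMap.codRestrict_apply] at this ⊢
      exact this
    · rintro ⟨x, hx⟩
      obtain ⟨y, rfl⟩ := hg x
      exact ⟨⟨y, hx⟩, rfl⟩

lemma Fil.finite [IsNoetherianRing A] (hΘ : ∀ M : ModuleCat.{u} A, Θ M → Module.Finite A M)
    (h : Fil Θ M) : Module.Finite A M := by
  induction h with
  | of_subsingleton => infer_instance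
  | @step M _ _ N hN hQ ih =>
    have : Module.Finite A (M ⧸ N) := hΘ _ hQ
    exact Module.Finite.of_submodule_quotient N

lemma Fil.filtered (hΘ : IsoClosed Θ) (h : Fil Θ M) : Filtered Θ (ModuleCat.of A M) := by
  induction h with
  | of_subsingleton => exact ⟨0, fun _ => ⊤, rfl, Subsingleton.elim _ _, fun i hi => by omega⟩
  | @step M _ _ N hN hQ ih =>
    obtain ⟨t, F, h0, ht, hF⟩ := ih
    let G : ℕ → Submodule A M := fun k => k.casesOn ⊤ fun k => (F k).map N.subtype
    refine ⟨t + 1, G, rfl, ?_, ?_⟩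
    · change (F t).map N.subtype = ⊥
      rw [ht]; exact Submodule.map_bot _
    · rintro (_ | k) hk
      · refine ⟨le_top, hΘ _ _ ?_ hQ⟩
        have : G (0 + 1) = N := by
          change (F 0).map N.subtype = N
          rw [h0]; exact Submodule.map_subtype_top N
        rw [this]
        refine (factorEquiv (N.mkQ ∘ₗ Submodule.subtype ⊤) ?_ ?_).symm
        · rw [LinearMap.ker_comp, Submodule.ker_mkQ]; rfl
        · exact N.mkQ_surjective.comp fun x => ⟨⟨x, trivial⟩, rfl⟩
      · have h1 := hF k (by omega)
        refine ⟨Submodule.map_mono h1.1, hΘ _ _ ?_ h1.2⟩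
        refine Submodule.Quotient.equiv _ _
          (Submodule.equivMapOfInjective N.subtype N.subtype_injective (F k)) ?_
        ext ⟨x, y, hy, rfl⟩
        simp only [Submodule.mem_map]
        constructor
        · rintro ⟨z, hz, h⟩
          have h2 := Subtype.ext_iff.1 h
          exact ⟨z, hz, h2⟩
        · rintro ⟨z, hz, h⟩
          obtain rfl : z = y := N.subtype_injective h
          exact ⟨⟨z, hy⟩, hz, rfl⟩

lemma Filtered.fil (hΘ : IsoClosed Θ) {M : ModuleCat.{u} A} (h : Filtered Θ M) : Fil Θ M := by
  obtain ⟨t, F, h0, ht, hF⟩ := h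
  -- The given filtration descends while `Fil` builds upwards, so it is traversed from its zero end.
  have key : ∀ k ≤ t, Fil Θ (F (t - k)) := by
    intro k
    induction k with
    | zero =>
      intro _
      have : Subsingleton (F (t - 0)) := by
        rw [Nat.sub_zero, ht]; infer_instance
      exact .of_subsingleton
    | succ k ih =>
      intro hk
      have h1 := hF (t - (k + 1)) (by omega)
      rw [show t - (k + 1) + 1 = t - k by omega] at h1
      exact .step ((ih (by omega)).equiv hΘ (Submodule.submoduleOfEquivOfLe h1.1).symm) h1.2
  have := key t le_rfl
  rw [Nat.sub_self, h0] at this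
  exact this.equiv hΘ Submodule.topEquiv

end Filtrations

/-! ### Traces of projectives and the standard modules. -/

section Traces

variable {A : Type u} [Ring A] {n : ℕ} {e : Fin n → A} {i j : Fin n} {k : ℕ}
  {M N M₁ M₂ M₃ : Type u} [AddCommGroup M] [Module A M] [AddCommGroup N] [Module A N]
  [AddCommGroup M₁] [Module A M₁] [AddCommGroup M₂] [Module A M₂] [AddCommGroup M₃] [Module A M₃]

/-- The trace in `M` of the projective modules `P(j)` with `j ≥ k`. -/
def trace (e : Fin n → A) (k : ℕ) (M : Type u) [AddCommGroup M] [Module A M] : Submodule A M :=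
  Submodule.span A {x | ∃ (j : Fin n) (y : M), k ≤ j ∧ e j • y = x}

lemma smul_mem_trace (h : k ≤ j) (x : M) : e j • x ∈ trace e k M :=
  Submodule.subset_span ⟨j, x, h, rfl⟩

lemma trace_le_iff {U : Submodule A M} :
    trace e k M ≤ U ↔ ∀ j : Fin n, k ≤ j → ∀ x : M, e j • x ∈ U := by
  rw [trace, Submodule.span_le]
  exact ⟨fun h j hj x => h ⟨j, x, hj, rfl⟩, fun h _ ⟨j, x, hj, hx⟩ => hx ▸ h j hj x⟩

lemma map_trace_le (f : M →ₗ[A] N) : trace e k M ≤ (trace e k N).comap f :=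
  trace_le_iff.2 fun j hj x => by
    rw [Submodule.mem_comap, map_smul]; exact smul_mem_trace hj _

/-- The trace is functorial. -/
def traceMap (e : Fin n → A) (k : ℕ) (f : M →ₗ[A] N) : trace e k M →ₗ[A] trace e k N :=
  f.restrict (map_trace_le f)

lemma traceMap_injective {f : M →ₗ[A] N} (hf : Function.Injective f) :
    Function.Injective (traceMap e k f) := fun x y h => by
  have h' := Subtype.ext_iff.1 h
  exact Subtype.ext (hf h')

/-- The trace is generated by elements `e j • x = e j • (e j • x)`, whose images lie in `e j • N =
0`. -/
lemma hom_trace_eq_zero (he : ∀ j, IsIdempotentElem (e j))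
    (hN : ∀ j : Fin n, k ≤ j → ∀ x : N, e j • x = 0) (f : trace e k M →ₗ[A] N) : f = 0 := by
  have : trace e k M ≤ (LinearMap.ker f).map (trace e k M).subtype :=
    trace_le_iff.2 fun j hj x => ⟨⟨e j • x, smul_mem_trace hj x⟩, by
      have h : (⟨e j • x, smul_mem_trace hj x⟩ : trace e k M) =
          e j • ⟨e j • x, smul_mem_trace hj x⟩ :=
        Subtype.ext (by simp [smul_smul, (he j).eq])
      rw [SetLike.mem_coe, LinearMap.mem_ker, h, map_smul, hN j hj], rfl⟩
  ext ⟨x, hx⟩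
  obtain ⟨y, hy, rfl⟩ := this hx
  exact hy

/-- The standard module `Δ(i)`. -/
abbrev Delta (e : Fin n → A) (i : Fin n) : Type u :=
  P e i ⧸ trace e (i + 1) (P e i)

lemma smul_Delta_eq_zero (h : i < j) (x : Delta e i) : e j • x = 0 := by
  obtain ⟨p, rfl⟩ := Submodule.mkQ_surjective _ x
  rw [← map_smul, Submodule.mkQ_apply, Submodule.Quotient.mk_eq_zero]
  exact smul_mem_trace h p

lemma Delta_extZero (he : ∀ j, IsIdempotentElem (e j))
    (hN : ∀ j, i < j → ∀ x : N, e j • x = 0) : ExtZero A (Delta e i) N 1 := by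
  have := P_projective (he i)
  refine extZero_one_of_exists_extension (Submodule.subtype_injective _) (exact_subtype_mkQ _)
    (Submodule.mkQ_surjective _) fun φ => ⟨0, ?_⟩
  rw [hom_trace_eq_zero he (fun j hj => hN j hj) φ, LinearMap.zero_comp]

variable [IsArtinianRing A] [IsNoetherianRing A]

/-- The quotient by `K` omits all `E(j)` with `j > i` exactly when `K` contains the trace, so the
trace is the least admissible `K`. -/
lemma isStandard_iff (he : IsBasicIdempotentSystem e) (M : ModuleCat.{u} A) :
    IsStandard e i M ↔ Nonempty (M ≃ₗ[A] Delta e i) := by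
  have hset : {K : Submodule A (P e i) | ∀ j > i,
      HasMultiplicity (A := A) (E e j) (P e i ⧸ K) 0} = Set.Ici (trace e (i + 1) (P e i)) := by
    ext K
    rw [Set.mem_ofPred_eq, Set.mem_Ici, trace_le_iff]
    refine forall₂_congr fun j hj => ?_
    rw [hasMultiplicity_zero_iff (he.primitive j), (Submodule.mkQ_surjective K).forall]
    refine forall_congr' fun x => ?_
    rw [← map_smul, Submodule.mkQ_apply, Submodule.Quotient.mk_eq_zero]
  unfold IsStandard
  rw [hset]
  constructor
  · rintro ⟨K, hK, ⟨φ⟩⟩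
    obtain rfl := hK.unique isLeast_Ici
    exact ⟨φ⟩
  · rintro ⟨φ⟩
    exact ⟨_, isLeast_Ici, ⟨φ⟩⟩

lemma standardClass_isoClosed (he : IsBasicIdempotentSystem e) :
    IsoClosed (standardClass e) := by
  rintro M N φ ⟨i, hi⟩
  obtain ⟨ψ⟩ := (isStandard_iff he M).1 hi
  exact ⟨i, (isStandard_iff he N).2 ⟨φ.symm.trans ψ⟩⟩

lemma fil_Delta (he : IsBasicIdempotentSystem e) : Fil (standardClass e) (Delta e i) :=
  .of_mem (standardClass_isoClosed he) ⟨i, (isStandard_iff he _).2 ⟨.refl A _⟩⟩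

omit [IsArtinianRing A] [IsNoetherianRing A] in
/-- If `M` is an extension of `Δ(i)` by a submodule `N` and `k ≤ i`, the trace of the `P(j)`,
`j ≥ k`, in `M` meets `N` in the trace in `N`. -/
lemma trace_inf_ker_le (hi : IsIdempotentElem (e i)) (hk : k ≤ i) {g : M →ₗ[A] Delta e i}
    (hidem : ∀ j, IsIdempotentElem (e j)) (hg : Function.Surjective g) :
    trace e k M ⊓ LinearMap.ker g ≤
      (trace e k (LinearMap.ker g)).map (LinearMap.ker g).subtype := by
  set L := (trace e k (LinearMap.ker g)).map (LinearMap.ker g).subtype with hL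
  have hmemL : ∀ (j : Fin n), k ≤ j → ∀ x : M, g (e j • x) = 0 → e j • x ∈ L := by
    intro j hj x hx
    refine ⟨e j • ⟨e j • x, hx⟩, smul_mem_trace hj _, ?_⟩
    simp [smul_smul, (hidem j).eq]
  have := P_projective hi
  -- Lift the projection `P(i) → Δ(i)` to `h : P(i) → M`. The trace of `M` lies in `L + h(P(i))`,
  -- and `l + h p` can be killed by `g` only if `p` is in the trace defining `Δ(i)`, which `h` sends
  -- into `L`.
  obtain ⟨h, hh⟩ := Module.projective_lifting_property g (Submodule.mkQ (trace e (i + 1) (P e i))) hg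
  have hhp : ∀ p, g (h p) = Submodule.mkQ (trace e (i + 1) (P e i)) p := LinearMap.congr_fun hh
  have hK : trace e (i + 1) (P e i) ≤ L.comap h := trace_le_iff.2 fun j hj p => by
    rw [Submodule.mem_comap, map_smul]
    refine hmemL j (by omega) _ ?_
    rw [map_smul, hhp]
    exact smul_Delta_eq_zero (Fin.lt_def.2 hj) _
  have hle : trace e k M ≤ L ⊔ LinearMap.range h := trace_le_iff.2 fun j hj x => by
    obtain ⟨p, hp⟩ := Submodule.mkQ_surjective _ (g x)
    have h1 : e j • x = e j • (x - h p) + h (e j • p) := by rw [map_smul, smul_sub]; abel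
    rw [h1]
    refine Submodule.add_mem_sup (hmemL j hj _ ?_) ⟨_, rfl⟩
    rw [map_smul, map_sub, hhp, hp, sub_self, smul_zero]
  rintro y ⟨hy, hy0⟩
  obtain ⟨l, hl, _, ⟨p, rfl⟩, rfl⟩ := Submodule.mem_sup.1 (hle hy)
  have hl0 : g l = 0 := by
    obtain ⟨z, -, rfl⟩ := hl
    exact z.2
  refine L.add_mem hl (hK ?_)
  rw [SetLike.mem_coe, LinearMap.mem_ker, map_add, hl0, zero_add, hhp] at hy0
  exact (Submodule.Quotient.mk_eq_zero _).1 hy0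

/-- `F(Δ)` is closed under traces of the modules `P(j)` with `j ≥ k`. -/
lemma fil_trace (he : IsBasicIdempotentSystem e) (k : ℕ) (h : Fil (standardClass e) M) :
    Fil (standardClass e) (trace e k M) := by
  have hidem := fun j => (he.primitive j).1
  induction h with
  | @of_subsingleton M _ _ _ => exact .of_subsingleton
  | @step M _ _ N hN hQ ih =>
    obtain ⟨i, hi⟩ := hQ
    obtain ⟨φ⟩ := (isStandard_iff he _).1 hi
    obtain ⟨g, hg, hker⟩ : ∃ g : M →ₗ[A] Delta e i, Function.Surjective g ∧
        LinearMap.ker g = N :=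
      ⟨φ.toLinearMap ∘ₗ N.mkQ, φ.surjective.comp N.mkQ_surjective, by
        rw [LinearMap.ker_comp, LinearEquiv.ker, Submodule.comap_bot, Submodule.ker_mkQ]⟩
    subst hker
    -- If `k ≤ i`, the trace of `M` maps onto `Δ(i)`, which is generated by the class of `e i`, and
    -- the kernel is the trace of the submodule. Otherwise `Δ(i)` has zero trace and both traces
    -- agree.
    by_cases hk : k ≤ i
    · refine .ext (standardClass_isoClosed he) (f := traceMap e k (LinearMap.ker g).subtype)
        (g := g ∘ₗ (trace e k M).subtype) ?_ ?_ ?_ ih (fil_Delta he)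
      · exact traceMap_injective (Submodule.subtype_injective _)
      · rintro ⟨y, hy⟩
        constructor
        · intro h0
          obtain ⟨z, hz, hzy⟩ := trace_inf_ker_le (hidem i) hk hidem hg ⟨hy, h0⟩
          exact ⟨⟨z, hz⟩, Subtype.ext hzy⟩
        · rintro ⟨z, hz⟩
          rw [← hz]
          exact z.1.2
      · intro x
        obtain ⟨p, rfl⟩ := Submodule.mkQ_surjective _ x
        obtain ⟨m, hm⟩ := hg (Submodule.mkQ _ (gen e i))
        refine ⟨(p : A) • ⟨e i • m, smul_mem_trace hk m⟩, ?_⟩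
        rw [map_smul]
        change (p : A) • g (e i • m) = _
        rw [map_smul, hm, ← map_smul, ← map_smul]
        congr 1
        rw [show e i • gen e i = gen e i from P_smul_gen (hidem i) (gen e i), P_smul_gen (hidem i)]
    · refine ih.equiv (standardClass_isoClosed he) (LinearEquiv.ofBijective
        (traceMap e k (LinearMap.ker g).subtype)
        ⟨traceMap_injective (Submodule.subtype_injective _), ?_⟩)
      have hle : trace e k M ≤ (trace e k (LinearMap.ker g)).map (LinearMap.ker g).subtype :=
        trace_le_iff.2 fun j hj x => by
          have h0 : g (e j • x) = 0 := by
            rw [map_smul]; exact smul_Delta_eq_zero (Fin.lt_def.2 (by omega)) _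
          refine ⟨e j • ⟨e j • x, h0⟩, smul_mem_trace hj _, ?_⟩
          simp [smul_smul, (hidem j).eq]
      rintro ⟨y, hy⟩
      obtain ⟨z, hz, hzy⟩ := hle hy
      exact ⟨⟨z, hz⟩, Subtype.ext hzy⟩

end Traces

/-! ### Proper costandard modules and Ext-orthogonality. -/

section ProperCostandard

variable {A : Type u} [Ring A] {n : ℕ} {e : Fin n → A} {i j : Fin n}
  {I : Type u} [AddCommGroup I] [Module A I]

/-- The maximal submodule of `I` without composition factors `E(k)`, `k > j`. -/
def nabla (e : Fin n → A) (j : Fin n) (I : Type u) [AddCommGroup I] [Module A I] :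
    Submodule A I where
  carrier := {x | ∀ (a : A) (k : Fin n), j < k → e k • a • x = 0}
  add_mem' hx hy a k hk := by rw [smul_add, smul_add, hx a k hk, hy a k hk, add_zero]
  zero_mem' a k hk := by rw [smul_zero, smul_zero]
  smul_mem' b x hx a k hk := by rw [smul_smul a b x]; exact hx _ k hk

/-- The maximal submodule `L` of `nabla e j I` with `eⱼ L ⊆ S`. -/
def nablaBar (e : Fin n → A) (j : Fin n) {I : Type u} [AddCommGroup I] [Module A I]
    (S : Submodule A I) : Submodule A I where
  carrier := {x | ∀ a : A, (∀ k : Fin n, j < k → e k • a • x = 0) ∧ e j • a • x ∈ S}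
  add_mem' hx hy a :=
    ⟨fun k hk => by rw [smul_add, smul_add, (hx a).1 k hk, (hy a).1 k hk, add_zero],
      by rw [smul_add, smul_add]; exact S.add_mem (hx a).2 (hy a).2⟩
  zero_mem' a := ⟨fun k hk => by rw [smul_zero, smul_zero],
    by rw [smul_zero, smul_zero]; exact S.zero_mem⟩
  smul_mem' b x hx a := by rw [smul_smul a b x]; exact hx _

lemma le_nabla_iff {U : Submodule A I} :
    U ≤ nabla e j I ↔ ∀ k, j < k → ∀ x ∈ U, e k • x = 0 :=
  ⟨fun h k hk x hx => by simpa using h hx 1 k hk, fun h x hx a k hk => h k hk _ (U.smul_mem a hx)⟩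

lemma le_nablaBar_iff {S U : Submodule A I} : U ≤ nablaBar e j S ↔
    (∀ k, j < k → ∀ x ∈ U, e k • x = 0) ∧ ∀ x ∈ U, e j • x ∈ S :=
  ⟨fun h => ⟨fun k hk x hx => by simpa using (h hx 1).1 k hk,
    fun x hx => by simpa using (h hx 1).2⟩,
    fun h x hx a => ⟨fun k hk => h.1 k hk _ (U.smul_mem a hx), h.2 _ (U.smul_mem a hx)⟩⟩

lemma smul_nablaBar_eq_zero {S : Submodule A I} {k : Fin n} (hk : j < k)
    {x : I} (hx : x ∈ nablaBar e j S) : e k • x = 0 :=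
  (le_nablaBar_iff.1 le_rfl).1 k hk x hx

lemma smul_nablaBar_mem {S : Submodule A I} {x : I} (hx : x ∈ nablaBar e j S) : e j • x ∈ S :=
  (le_nablaBar_iff.1 le_rfl).2 x hx

/-- `Ext¹(Δ(i), ∇̄(j)) = 0`. -/
lemma Delta_nablaBar_extZero (he : ∀ j, IsIdempotentElem (e j)) [Module.Injective A I]
    (S : Submodule A I) : ExtZero A (Delta e i) (nablaBar e j S) 1 := by
  -- For `j ≤ i` there are no maps from the kernel of `P(i) → Δ(i)` to the proper costandard module.
  -- For `i < j`, maps extend to `P(i) → I` by injectivity. The extension stays in `nablaBar`: for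
  -- `k ≥ j` the element `e k • p` lies in the kernel, where the map is already known.
  rcases le_or_gt j i with hij | hij
  · exact Delta_extZero he fun k hk x =>
      Subtype.ext (smul_nablaBar_eq_zero (hij.trans_lt hk) x.2)
  have := P_projective (he i)
  refine extZero_one_of_exists_extension (Submodule.subtype_injective _) (exact_subtype_mkQ _)
    (Submodule.mkQ_surjective _) fun φ => ?_
  obtain ⟨h, hh⟩ := Module.Injective.out _ (Submodule.subtype_injective
    (trace e (i + 1) (P e i))) ((nablaBar e j S).subtype ∘ₗ φ)
  have key : ∀ k, i < k → ∀ p : P e i, e k • p ∈ trace e (i + 1) (P e i) ∧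
      ∃ y ∈ nablaBar e j S, e k • h p = e k • y := by
    intro k hk p
    have hmem : e k • p ∈ trace e (i + 1) (P e i) := smul_mem_trace (Fin.lt_def.1 hk) p
    refine ⟨hmem, φ ⟨e k • p, hmem⟩, (φ _).2, ?_⟩
    have := hh ⟨e k • p, hmem⟩
    change h (e k • p) = φ ⟨e k • p, hmem⟩ at this
    rw [← this, map_smul, smul_smul, (he k).eq]
  have hrange : LinearMap.range h ≤ nablaBar e j S := by
    refine le_nablaBar_iff.2 ⟨?_, ?_⟩
    · rintro k hk _ ⟨p, rfl⟩
      obtain ⟨-, y, hy, hpy⟩ := key k (hij.trans hk) p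
      rw [hpy, smul_nablaBar_eq_zero hk hy]
    · rintro _ ⟨p, rfl⟩
      obtain ⟨-, y, hy, hpy⟩ := key j hij p
      rw [hpy]
      exact smul_nablaBar_mem hy
  exact ⟨h.codRestrict _ fun p => hrange ⟨p, rfl⟩, LinearMap.ext fun x => Subtype.ext (hh x)⟩

variable [IsArtinianRing A] [IsNoetherianRing A]

/-- A submodule of the injective envelope of `E(j)` contains `E(j)` with multiplicity one iff it
is nonzero and its `j`-part lies in the socle. -/
lemma hasMultiplicity_one_iff_of_le (he : IsBasicIdempotentSystem e) [Module.Finite A I]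
    {S : Submodule A I} (hS : IsSimpleModule A S) (hjS : ∃ x ∈ S, e j • x ≠ 0)
    (hess : ∀ N : Submodule A I, N ⊓ S = ⊥ → N = ⊥) (L : Submodule A I) :
    HasMultiplicity (A := A) (E e j) L 1 ↔ S ≤ L ∧ ∀ x ∈ L, e j • x ∈ S := by
  have hatom : IsAtom S := isSimpleModule_iff_isAtom.1 hS
  have hle : ∀ N : Submodule A I, N ≠ ⊥ → S ≤ N := fun N hN =>
    inf_eq_right.1 ((hatom.le_iff_eq fun h => hN (hess N h)).1 inf_le_right)
  have main : S ≤ L → (HasMultiplicity (A := A) (E e j) L 1 ↔ ∀ x ∈ L, e j • x ∈ S) := by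
    intro hSL
    have hsimple : IsSimpleModule A (S.submoduleOf L) :=
      IsSimpleModule.congr (Submodule.submoduleOfEquivOfLe hSL)
    rw [hasMultiplicity_one_iff (he.primitive j) hsimple]
    · exact ⟨fun h x hx => h ⟨x, hx⟩, fun h x => h x x.2⟩
    · obtain ⟨x, hx, hx0⟩ := hjS
      exact ⟨⟨x, hSL hx⟩, hx, fun h => hx0 (congrArg Subtype.val h)⟩
    · intro U hU x hx
      have h1 : U.map L.subtype ≠ ⊥ := fun h => hU <|
        Submodule.map_injective_of_injective L.subtype_injective (h.trans (Submodule.map_bot _).symm)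
      obtain ⟨y, hy, hyx⟩ := hle _ h1 hx
      obtain rfl : y = x := Subtype.ext hyx
      exact hy
  refine ⟨fun h => ?_, fun h => (main h.1).2 h.2⟩
  have hSL : S ≤ L := by
    refine hle L fun hL => ?_
    obtain ⟨s, -, -, hs⟩ := (hasMultiplicity_iff_of_series (he.primitive j)).1 h
    obtain ⟨a, ha⟩ := Set.ncard_eq_one.1 hs
    obtain ⟨x, -, hx⟩ := ha.symm ▸ Set.mem_singleton a
    have : x = 0 := Subtype.ext ((Submodule.mem_bot A).1 (hL ▸ x.2))
    refine hx ?_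
    rw [this, smul_zero]
    exact Submodule.zero_mem _
  exact ⟨hSL, (main hSL).1 h⟩

/-- In the injective envelope of `E(j)` with socle `S`, the proper costandard submodule is
`nablaBar e j S`. -/
lemma isGreatest_iff_eq_nablaBar (he : IsBasicIdempotentSystem e) [Module.Finite A I]
    {S : Submodule A I} (hS : IsSimpleModule A S) (hjS : ∃ x ∈ S, e j • x ≠ 0)
    (hess : ∀ N : Submodule A I, N ⊓ S = ⊥ → N = ⊥) (L : Submodule A I) :
    (∃ N, IsGreatest {N : Submodule A I | ∀ k > j, HasMultiplicity (A := A) (E e k) N 0} N ∧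
      IsGreatest {L : Submodule A I | L ≤ N ∧ HasMultiplicity (A := A) (E e j) L 1} L) ↔
    L = nablaBar e j S := by
  have hset : {N : Submodule A I | ∀ k > j, HasMultiplicity (A := A) (E e k) N 0} =
      Set.Iic (nabla e j I) := by
    ext N
    rw [Set.mem_ofPred_eq, Set.mem_Iic, le_nabla_iff]
    refine forall₂_congr fun k hk => ?_
    rw [hasMultiplicity_zero_iff (he.primitive k)]
    exact ⟨fun h x hx => congrArg Subtype.val (h ⟨x, hx⟩), fun h x => Subtype.ext (h x x.2)⟩
  -- Only one of the idempotents acts nontrivially on a simple module, and on `S` it is `e j`.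
  have hkS : ∀ k, j < k → ∀ x ∈ S, e k • x = 0 := by
    intro k hk x hx
    by_contra h
    obtain ⟨y, hy, hy0⟩ := hjS
    exact hk.ne (eq_of_smul_ne_zero he (M := S) (x := ⟨y, hy⟩) (y := ⟨x, hx⟩)
      (fun h' => hy0 (congrArg Subtype.val h')) fun h' => h (congrArg Subtype.val h'))
  have hgreat : IsGreatest {L : Submodule A I | L ≤ nabla e j I ∧
      HasMultiplicity (A := A) (E e j) L 1} (nablaBar e j S) := by
    constructor
    · rw [Set.mem_ofPred_eq, hasMultiplicity_one_iff_of_le he hS hjS hess]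
      exact ⟨le_nabla_iff.2 (le_nablaBar_iff.1 le_rfl).1,
        le_nablaBar_iff.2 ⟨hkS, fun x hx => S.smul_mem _ hx⟩, (le_nablaBar_iff.1 le_rfl).2⟩
    · intro L hL
      rw [Set.mem_ofPred_eq, hasMultiplicity_one_iff_of_le he hS hjS hess] at hL
      exact le_nablaBar_iff.2 ⟨le_nabla_iff.1 hL.1, hL.2.2⟩
  rw [hset]
  constructor
  · rintro ⟨N, hN, hL⟩
    obtain rfl := hN.unique isGreatest_Iic
    exact hL.unique hgreat
  · rintro rfl
    exact ⟨_, isGreatest_Iic, hgreat⟩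

omit [IsArtinianRing A] [IsNoetherianRing A] in
lemma exists_range_smul_ne_zero {f : E e j →ₗ[A] I} (hf : Function.Injective f)
    (h : ∃ x : E e j, e j • x ≠ 0) : ∃ x ∈ LinearMap.range f, e j • x ≠ 0 := by
  obtain ⟨x, hx⟩ := h
  refine ⟨f x, ⟨x, rfl⟩, fun h => hx (hf ?_)⟩
  rw [map_smul, h, map_zero]

lemma IsProperCostandard.exists_nablaBar (he : IsBasicIdempotentSystem e) {M : ModuleCat.{u} A}
    (hM : IsProperCostandard e j M) : ∃ (I : ModuleCat.{u} A) (S : Submodule A I),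
      Module.Finite A I ∧ Module.Injective A I ∧ Nonempty (M ≃ₗ[A] nablaBar e j S) := by
  obtain ⟨I, ⟨hfin, hinj, f, hf, hess⟩, N, L, hN, hL, hφ⟩ := hM
  have : IsSimpleModule A (E e j) := E_isSimple (he.primitive j)
  obtain rfl := (isGreatest_iff_eq_nablaBar he
    (IsSimpleModule.congr (LinearEquiv.ofInjective f hf).symm)
    (exists_range_smul_ne_zero hf (exists_smul_ne_zero_E (he.primitive j))) hess L).1 ⟨N, hN, hL⟩
  exact ⟨I, _, hfin, hinj, hφ⟩

lemma exists_isProperCostandard (R : Type v) [CommRing R] [IsArtinianRing R] [Algebra R A]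
    [Module.Finite R A] (he : IsBasicIdempotentSystem e) (j : Fin n) :
    ∃ (I : ModuleCat.{u} A) (S : Submodule A I), Module.Finite A I ∧ IsSimpleModule A S ∧
      (∃ x ∈ S, e j • x ≠ 0) ∧ (∀ N : Submodule A I, N ⊓ S = ⊥ → N = ⊥) ∧
      S ≤ nablaBar e j S ∧ IsProperCostandard e j (ModuleCat.of A (nablaBar e j S)) := by
  have : IsSimpleModule A (E e j) := E_isSimple (he.primitive j)
  obtain ⟨I, hI⟩ := exists_isInjectiveEnvelope (A := A) R (E e j)
  obtain ⟨hfin, hinj, f, hf, hess⟩ := id hI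
  have hS : IsSimpleModule A (LinearMap.range f) :=
    IsSimpleModule.congr (LinearEquiv.ofInjective f hf).symm
  have hjS := exists_range_smul_ne_zero hf (exists_smul_ne_zero_E (he.primitive j))
  obtain ⟨N, hN, hL⟩ := (isGreatest_iff_eq_nablaBar he hS hjS hess _).2 rfl
  exact ⟨I, LinearMap.range f, hfin, hS, hjS, hess,
    ((hasMultiplicity_one_iff_of_le he hS hjS hess _).1 hL.1.2).1,
    I, hI, N, _, hN, hL, ⟨.refl A _⟩⟩

omit [IsArtinianRing A] [IsNoetherianRing A] in
lemma properCostandardClass_isoClosed : IsoClosed (properCostandardClass e) := by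
  rintro M N φ ⟨j, I, hI, U, L, hU, hL, ⟨ψ⟩⟩
  exact ⟨j, I, hI, U, L, hU, hL, ⟨φ.symm.trans ψ⟩⟩

lemma standardClass_finite (he : IsBasicIdempotentSystem e) (M : ModuleCat.{u} A)
    (hM : standardClass e M) : Module.Finite A M := by
  obtain ⟨i, hi⟩ := hM
  obtain ⟨φ⟩ := (isStandard_iff he M).1 hi
  exact Module.Finite.equiv φ.symm

omit [IsArtinianRing A] [IsNoetherianRing A] in
lemma Fil.induction_extZero {Θ : ObjectProperty (ModuleCat.{u} A)} {M X : Type u}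
    [AddCommGroup M] [Module A M] [AddCommGroup X] [Module A X] {k : ℕ}
    (hM : Fil Θ M) (h : ∀ N : ModuleCat.{u} A, Θ N → ExtZero A N X k) : ExtZero A M X k := by
  induction hM with
  | of_subsingleton => exact extZero_of_subsingleton_left k
  | @step M _ _ N _ hQ ih =>
    exact ih.middle_left N.subtype_injective (exact_subtype_mkQ N) N.mkQ_surjective (h _ hQ)

omit [IsArtinianRing A] [IsNoetherianRing A] in
lemma Fil.induction_extZero_right {Θ : ObjectProperty (ModuleCat.{u} A)} {M X : Type u}
    [AddCommGroup M] [Module A M] [AddCommGroup X] [Module A X] {k : ℕ}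
    (hX : Fil Θ X) (h : ∀ N : ModuleCat.{u} A, Θ N → ExtZero A M N k) : ExtZero A M X k := by
  induction hX with
  | of_subsingleton => exact extZero_of_subsingleton_right k
  | @step X _ _ N _ hQ ih =>
    exact ih.middle_right N.subtype_injective (exact_subtype_mkQ N) N.mkQ_surjective (h _ hQ)

/-- If `A` is standardly stratified, `Ext^k(F(Δ), ∇̄) = 0` for `k ≥ 1`. -/
lemma fil_extZero_nablaBar (he : IsBasicIdempotentSystem e) (hA : IsStandardlyStratified e)
    [Module.Injective A I] (S : Submodule A I) (k : ℕ) {M : Type u} [AddCommGroup M] [Module A M]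
    (hM : Fil (standardClass e) M) : ExtZero A M (nablaBar e j S) (k + 1) := by
  have hidem := fun j => (he.primitive j).1
  induction k generalizing M with
  | zero =>
    refine hM.induction_extZero fun N ⟨i, hi⟩ => ?_
    obtain ⟨φ⟩ := (isStandard_iff he N).1 hi
    exact .of_equiv φ (Delta_nablaBar_extZero hidem S)
  | succ k ih =>
    refine hM.induction_extZero fun N ⟨i, hi⟩ => ?_
    obtain ⟨φ⟩ := (isStandard_iff he N).1 hi
    have hproj := P_projective (hidem i)
    refine .of_equiv φ (ExtZero.quot_left (Submodule.subtype_injective _) (exact_subtype_mkQ _)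
      (Submodule.mkQ_surjective _) ?_ (extZero_of_projective (M := P e i) (k + 1)))
    -- Dimension shift to the kernel of `P(i) → Δ(i)`. It is a direct summand of the trace of `A`,
    -- which lies in `F(Δ)` by standard stratification; Ext-vanishing passes to summands without
    -- showing that `F(Δ)` is closed under them.
    refine ExtZero.of_retract (M₁ := trace e (i + 1) A) (traceMap e (i + 1) (P e i).subtype)
      (traceMap e (i + 1) (LinearMap.toSpanSingleton A (P e i) (gen e i))) ?_
      (ih (fil_trace he _ (hA.fil (standardClass_isoClosed he))))
    ext ⟨p, hp⟩
    exact congrArg Subtype.val (P_smul_gen (hidem i) p)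

/-- If `A` is standardly stratified, `Ext^k(F(Δ), F(∇̄)) = 0` for `k ≥ 1`. -/
theorem fil_extZero_fil (he : IsBasicIdempotentSystem e) (hA : IsStandardlyStratified e)
    (k : ℕ) {M X : Type u} [AddCommGroup M] [Module A M] [AddCommGroup X] [Module A X]
    (hM : Fil (standardClass e) M) (hX : Fil (properCostandardClass e) X) :
    ExtZero A M X (k + 1) := by
  refine hX.induction_extZero_right fun N ⟨j, hj⟩ => ?_
  obtain ⟨I, S, hfin, hinj, ⟨φ⟩⟩ := hj.exists_nablaBar he
  exact .of_equiv_right φ (fil_extZero_nablaBar he hA S k hM)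

end ProperCostandard

/-! ### Modules without extensions by standard modules have good filtrations. -/

section GoodModules

variable {A : Type u} [Ring A] {n : ℕ} {e : Fin n → A} {i j k : Fin n}
  {I X : Type u} [AddCommGroup I] [Module A I] [AddCommGroup X] [Module A X]

lemma exists_hom_range_of_ker_le {Z : Type u} [AddCommGroup Z] [Module A Z] (f : Z →ₗ[A] I)
    (m : Z →ₗ[A] X) (h : LinearMap.ker f ≤ LinearMap.ker m) :
    ∃ ψ : LinearMap.range f →ₗ[A] X, ∀ z, ψ ⟨f z, z, rfl⟩ = m z := by
  refine ⟨(LinearMap.ker f).liftQ m h ∘ₗ f.quotKerEquivRange.symm.toLinearMap, fun z => ?_⟩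
  have : f.quotKerEquivRange.symm ⟨f z, z, rfl⟩ = Submodule.Quotient.mk z := by
    rw [LinearEquiv.symm_apply_eq]; rfl
  rw [LinearMap.comp_apply, LinearEquiv.coe_coe, this]
  rfl

/-- Let `B` be a module and `h : P(k) → B` such that the part of `B` above `k` is contained in
the submodule `U`. If `Ext¹(Δ(k), X) = 0` and `X` has no nonzero submodule concentrated in degrees
`≤ k`, homomorphisms `U → X` extend to `U + h(P(k))`. -/
lemma exists_extension_sup_range (hX : ExtZero A (Delta e k) X 1)
    (hV : ∀ V : Submodule A X, (∀ l, k < l → ∀ x ∈ V, e l • x = 0) → V = ⊥)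
    {U : Submodule A I} (h : P e k →ₗ[A] I) (hU : ∀ l, k < l → ∀ p, e l • h p ∈ U)
    (ψ : U →ₗ[A] X) :
    ∃ ψ' : LinearMap.range (U.subtype.coprod h) →ₗ[A] X,
      ∀ u : U, ψ' ⟨U.subtype.coprod h (u, 0), (u, 0), rfl⟩ = ψ u := by
  let φ : U.comap h →ₗ[A] X := ψ ∘ₗ h.restrict (p := U.comap h) (q := U) fun x hx => hx
  have htr : trace e (k + 1) (P e k) ≤ U.comap h := trace_le_iff.2 fun l hl p => by
    rw [Submodule.mem_comap, map_smul]; exact hU l (Fin.lt_def.2 hl) p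
  obtain ⟨χ, hχ⟩ := hX.exists_extension (Submodule.subtype_injective _) (exact_subtype_mkQ _)
    (Submodule.mkQ_surjective _) (φ ∘ₗ Submodule.inclusion htr)
  -- `δ` vanishes on `e l • p` for `l > k`, so its image is concentrated in degrees `≤ k` and is
  -- zero by `hV`. Thus `ψ ∘ h` and `χ` agree wherever both are defined, and they glue.
  let δ : U.comap h →ₗ[A] X := φ - χ ∘ₗ (U.comap h).subtype
  have hδ : LinearMap.range δ = ⊥ := by
    refine hV _ ?_
    rintro l hl _ ⟨p, rfl⟩
    have hmem : e l • (p : P e k) ∈ trace e (k + 1) (P e k) := smul_mem_trace (Fin.lt_def.1 hl) _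
    rw [← map_smul]
    exact sub_eq_zero.2 (LinearMap.congr_fun hχ ⟨_, hmem⟩).symm
  have hφχ : ∀ (p : P e k) (hp : h p ∈ U), ψ ⟨h p, hp⟩ = χ p := fun p hp =>
    sub_eq_zero.1 (LinearMap.congr_fun (LinearMap.range_eq_bot.1 hδ) ⟨p, hp⟩)
  obtain ⟨ψ', hψ'⟩ := exists_hom_range_of_ker_le (U.subtype.coprod h) (ψ.coprod χ) (by
    rintro ⟨u, p⟩ hup
    rw [LinearMap.mem_ker, LinearMap.coprod_apply] at hup ⊢
    have hp : h p = ((-u : U) : I) := (neg_eq_of_add_eq_zero_right hup).symm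
    rw [← hφχ p (hp ▸ (-u).2), ← map_add]
    have : u + ⟨h p, hp ▸ (-u).2⟩ = 0 := Subtype.ext hup
    rw [this, map_zero])
  exact ⟨ψ', fun u => by rw [hψ', LinearMap.coprod_apply, map_zero, add_zero]⟩

variable [IsNoetherianRing A]

/-- Take a maximal `U` over `S` to which `σ` extends, and the largest `k` whose part of `nablaBar`
is not inside `U`. Then `k < j`, since higher idempotents kill `nablaBar` and `e j` maps it into
`S`. Adjoining an image of `P(k)` enlarges `U`, a contradiction. -/
lemma exists_extension_nablaBar (he : IsBasicIdempotentSystem e) [Module.Finite A I]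
    (hX : ∀ i, ExtZero A (Delta e i) X 1)
    (hV : ∀ k, k < j → ∀ V : Submodule A X, (∀ l, k < l → ∀ x ∈ V, e l • x = 0) → V = ⊥)
    {S : Submodule A I} (hS : S ≤ nablaBar e j S) (σ : S →ₗ[A] X) :
    ∃ ψ : nablaBar e j S →ₗ[A] X, ∀ s : S, ψ ⟨s, hS s.2⟩ = σ s := by
  let 𝒰 : Set (Submodule A I) := {U | U ≤ nablaBar e j S ∧ ∃ (h : S ≤ U) (ψ : U →ₗ[A] X),
    ∀ s : S, ψ ⟨s, h s.2⟩ = σ s}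
  obtain ⟨U, hU, hmax⟩ := wellFounded_gt.has_min 𝒰 ⟨S, hS, le_rfl, σ, fun s => rfl⟩
  obtain ⟨hUB, hSU, ψ, hψ⟩ := hU
  by_cases hBU : nablaBar e j S ≤ U
  · obtain rfl := le_antisymm hUB hBU
    exact ⟨ψ, hψ⟩
  exfalso
  obtain ⟨x, hx, hxU⟩ := SetLike.not_le_iff_exists.1 hBU
  obtain ⟨k, hk, hkmax⟩ := (wellFounded_gt (α := Fin n)).has_min
    {k | ∃ x ∈ nablaBar e j S, e k • x ∉ U} ((exists_smul_not_mem he hxU).imp fun k hk => ⟨x, hx, hk⟩)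
  clear x hx hxU
  obtain ⟨x, hx, hxU⟩ := hk
  have hkj : k < j := by
    by_contra! h
    rcases h.lt_or_eq with h | rfl
    · exact hxU (smul_nablaBar_eq_zero h hx ▸ U.zero_mem)
    · exact hxU (hSU (smul_nablaBar_mem hx))
  obtain ⟨ψ', hψ'⟩ := exists_extension_sup_range (hX k) (hV k hkj) (homOfElement e k x)
    (fun l hl p => by
      by_contra h
      exact hkmax l ⟨_, (nablaBar e j S).smul_mem _ hx, h⟩ hl) ψ
  have hUU' : U ≤ LinearMap.range (U.subtype.coprod (homOfElement e k x)) := fun u hu =>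
    ⟨(⟨u, hu⟩, 0), by rw [LinearMap.coprod_apply, map_zero, add_zero]; rfl⟩
  refine hmax (LinearMap.range (U.subtype.coprod (homOfElement e k x)))
    ⟨?_, hSU.trans hUU', ψ', fun s => ?_⟩ ?_
  · rintro _ ⟨⟨u, p⟩, rfl⟩
    exact Submodule.add_mem _ (hUB u.2) (Submodule.smul_mem _ _ hx)
  · rw [← hψ, ← hψ']
    congr 1
    refine Subtype.ext ?_
    change (s : I) = U.subtype _ + homOfElement e k x 0
    rw [map_zero, add_zero]; rfl
  · refine lt_of_le_of_ne hUU' fun h => hxU ?_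
    rw [h]
    exact ⟨(0, gen e k), by rw [LinearMap.coprod_apply, map_zero, zero_add]; rfl⟩

variable [IsArtinianRing A]

/-- A nonzero module `X` with `Ext¹(Δ, X) = 0` has a proper costandard submodule. -/
lemma exists_injective_hom_nablaBar (R : Type v) [CommRing R] [IsArtinianRing R] [Algebra R A]
    [Module.Finite R A] (he : IsBasicIdempotentSystem e) [Module.Finite A X] [Nontrivial X]
    (hX : ∀ i, ExtZero A (Delta e i) X 1) :
    ∃ (j : Fin n) (I : ModuleCat.{u} A) (S : Submodule A I) (ψ : nablaBar e j S →ₗ[A] X),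
      Function.Injective ψ ∧ nablaBar e j S ≠ ⊥ ∧
      IsProperCostandard e j (ModuleCat.of A (nablaBar e j S)) := by
  obtain ⟨x, hx⟩ := exists_ne (0 : X)
  obtain ⟨i₀, -⟩ := exists_smul_not_mem he (U := ⊥) (x := x) (fun h => hx ((Submodule.mem_bot A).1 h))
  -- `j` is the least index such that `X` has a nonzero submodule with all factors `E(l)`, `l ≤ j`.
  -- The index `n - 1` qualifies with the whole module; `i₀` only ensures `n > 0`.
  obtain ⟨j, ⟨V, hV, hVj⟩, hmin⟩ := (wellFounded_lt (α := Fin n)).has_min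
    {j | ∃ V : Submodule A X, V ≠ ⊥ ∧ ∀ l, j < l → ∀ x ∈ V, e l • x = 0}
    ⟨⟨n - 1, by have := i₀.2; omega⟩, ⊤, top_ne_bot, fun l hl => by
      have := l.2; rw [Fin.lt_def] at hl; simp only at hl; omega⟩
  have hmin' : ∀ k, k < j → ∀ V : Submodule A X, (∀ l, k < l → ∀ x ∈ V, e l • x = 0) → V = ⊥ :=
    fun k hk V h => by_contra fun hV => hmin k ⟨V, hV, h⟩ hk
  obtain ⟨S₀, hatom, hS₀V⟩ := (eq_bot_or_exists_atom_le V).resolve_left hV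
  have hsimple : IsSimpleModule A S₀ := isSimpleModule_iff_isAtom.2 hatom
  obtain ⟨y, hy⟩ := @exists_ne S₀ (IsSimpleModule.nontrivial A S₀) 0
  obtain ⟨i, hi⟩ := exists_smul_not_mem he (U := (⊥ : Submodule A S₀)) (x := y)
    (fun h => hy ((Submodule.mem_bot A).1 h))
  rw [Submodule.mem_bot] at hi
  -- The simple submodule is some `E(i)`: inside `V` this forces `i ≤ j`, and minimality of `j`
  -- forces `j ≤ i`.
  have hij : i = j := by
    refine le_antisymm ?_ ?_
    · by_contra! h
      exact hi (Subtype.ext (hVj i h y (hS₀V y.2)))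
    · by_contra! h
      refine hatom.1 (hmin' i h S₀ fun l hl x hx => ?_)
      by_contra h0
      exact hl.ne (eq_of_smul_ne_zero he (x := y) (y := (⟨x, hx⟩ : S₀)) hi
        fun h' => h0 (congrArg Subtype.val h'))
  subst hij
  obtain ⟨φ₀⟩ := nonempty_equiv_E (he.primitive i) hi
  obtain ⟨I, S, hfin, hS, ⟨s, hs, hs0⟩, hess, hle, hpc⟩ := exists_isProperCostandard R he i
  obtain ⟨φ⟩ := nonempty_equiv_E (M := S) (he.primitive i) (x := ⟨s, hs⟩)
    fun h => hs0 (congrArg Subtype.val h)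
  obtain ⟨ψ, hψ⟩ := exists_extension_nablaBar he hX hmin' hle
    (S₀.subtype ∘ₗ (φ.trans φ₀.symm).toLinearMap)
  refine ⟨i, I, S, ψ, ?_, fun h => ?_, hpc⟩
  -- `ψ` is injective on `S`, so its kernel meets the essential submodule `S` trivially.
  · rw [← LinearMap.ker_eq_bot]
    refine Submodule.map_injective_of_injective (Submodule.subtype_injective _)
      (Eq.trans (hess _ ((Submodule.eq_bot_iff _).2 ?_)) (Submodule.map_bot _).symm)
    rintro _ ⟨⟨z, hz, rfl⟩, hzS⟩
    have h1 : ψ ⟨z, hle hzS⟩ = 0 := hz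
    have h2 := (hψ ⟨z, hzS⟩).symm.trans h1
    have h3 : (φ.trans φ₀.symm) ⟨z, hzS⟩ = 0 := Subtype.ext h2
    exact congrArg Subtype.val ((LinearEquiv.map_eq_zero_iff _).1 h3)
  · exact (isSimpleModule_iff_isAtom.1 hS).1 (eq_bot_iff.2 (h ▸ hle))

/-- If `A` is standardly stratified, the finitely generated modules `X` with `Ext¹(Δ, X) = 0`
belong to `F(∇̄)`. -/
theorem fil_properCostandard_of_extZero (R : Type v) [CommRing R] [IsArtinianRing R] [Algebra R A]
    [Module.Finite R A] (he : IsBasicIdempotentSystem e) (hA : IsStandardlyStratified e)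
    [Module.Finite A X] (hX : ∀ i, ExtZero A (Delta e i) X 1) :
    Fil (properCostandardClass e) X := by
  have hiso := properCostandardClass_isoClosed (e := e)
  -- Noetherian induction on `W`: splitting off a proper costandard submodule of `X ⧸ W` enlarges
  -- `W`.
  suffices h : ∀ W : Submodule A X, (∀ i, ExtZero A (Delta e i) (X ⧸ W) 1) →
      Fil (properCostandardClass e) (X ⧸ W) from
    (h ⊥ fun i => .of_equiv_right (Submodule.quotEquivOfEqBot _ rfl) (hX i)).equiv hiso
      (Submodule.quotEquivOfEqBot _ rfl)
  intro W
  induction W using WellFoundedGT.induction with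
  | ind W ih =>
  intro hW
  rcases subsingleton_or_nontrivial (X ⧸ W) with hsub | hnon
  · exact .of_subsingleton
  obtain ⟨j, I, S, ψ, hψ, hne, hpc⟩ := exists_injective_hom_nablaBar R he hW
  have hexact : Function.Exact ψ (LinearMap.range ψ).mkQ := by
    rw [LinearMap.exact_iff, Submodule.ker_mkQ]
  have hcomap := quotComapEquiv W.mkQ_surjective (LinearMap.range ψ)
  have hquot : Fil (properCostandardClass e) ((X ⧸ W) ⧸ LinearMap.range ψ) := by
    refine (ih ((LinearMap.range ψ).comap W.mkQ) ?_ fun i => ?_).equiv hiso hcomap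
    · refine lt_of_le_of_ne (fun x hx => ?_) fun h => hne ?_
      · rw [Submodule.mem_comap, Submodule.mkQ_apply, (Submodule.Quotient.mk_eq_zero W).2 hx]
        exact Submodule.zero_mem _
      · have h1 : LinearMap.range ψ = ⊥ := by
          refine (Submodule.eq_bot_iff _).2 fun x hx => ?_
          obtain ⟨y, rfl⟩ := W.mkQ_surjective x
          have hy : y ∈ (LinearMap.range ψ).comap W.mkQ := hx
          rw [← h] at hy
          exact (Submodule.Quotient.mk_eq_zero W).2 hy
        refine (Submodule.eq_bot_iff _).2 fun x hx => ?_
        have h2 : ψ ⟨x, hx⟩ = ψ 0 := by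
          rw [map_zero]
          exact (Submodule.mem_bot A).1 (h1 ▸ ⟨_, rfl⟩)
        exact congrArg Subtype.val (hψ h2)
    · refine .of_equiv_right hcomap (ExtZero.quot_right hψ hexact (Submodule.mkQ_surjective _)
        (hW i) ?_)
      -- The quotient keeps `Ext¹(Δ, -) = 0` because `Ext²(Δ, ∇̄) = 0`.
      exact fil_extZero_fil he hA 1 (fil_Delta he) (.of_mem hiso ⟨j, hpc⟩)
  exact .ext hiso hψ hexact (Submodule.mkQ_surjective _) (.of_mem hiso ⟨j, hpc⟩) hquot

end GoodModules

/-! ### Universal extensions and approximation by good modules. -/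

section UniversalExtensions

variable {A : Type u} [Ring A] {n : ℕ} {e : Fin n → A} {i j : Fin n}
  {X : Type u} [AddCommGroup X] [Module A X]

/-- Multiplication by an element of the central subring `R`. -/
def centralSMul (A : Type u) [Ring A] {R : Type v} [CommRing R] [Algebra R A] (r : R)
    (M : Type u) [AddCommGroup M] [Module A M] : M →ₗ[A] M where
  toFun x := algebraMap R A r • x
  map_add' := smul_add _
  map_smul' a x := by rw [smul_smul, RingHom.id_apply, smul_smul, Algebra.commutes]

lemma exists_finite_hom_generators (R : Type v) [CommRing R] [IsNoetherianRing R] [Algebra R A]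
    [Module.Finite R A] (K X : Type u) [AddCommGroup K] [Module A K] [AddCommGroup X] [Module A X]
    [Module.Finite A K] [Module.Finite A X] :
    ∃ (m : ℕ) (g : Fin m → K →ₗ[A] X), ∀ φ : K →ₗ[A] X, ∃ r : Fin m → R,
      φ = ∑ s, g s ∘ₗ centralSMul A (r s) K := by
  let modR : Module R X := Module.compHom X (algebraMap R A)
  have tower : IsScalarTower R A X := ⟨fun r a x => by
    change (r • a) • x = algebraMap R A r • a • x
    rw [smul_smul, Algebra.smul_def]⟩
  have comm : SMulCommClass A R X := ⟨fun a r x => by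
    change a • algebraMap R A r • x = algebraMap R A r • a • x
    rw [smul_smul, smul_smul, Algebra.commutes]⟩
  have := isNoetherian_hom_of_finite (A := A) (R := R) (K := K) (X := X)
  obtain ⟨m, g, hg⟩ := Module.Finite.exists_fin (R := R) (M := K →ₗ[A] X)
  refine ⟨m, g, fun φ => ?_⟩
  obtain ⟨r, hr⟩ := (Submodule.mem_span_range_iff_exists_fun R).1
    (hg ▸ Submodule.mem_top : φ ∈ Submodule.span R (Set.range g))
  refine ⟨r, hr.symm.trans (Finset.sum_congr rfl fun s _ => LinearMap.ext fun x => ?_)⟩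
  exact (map_smul (g s) (algebraMap R A (r s)) x).symm

section Pushout

variable {m : ℕ} (g : Fin m → trace e (i + 1) (P e i) →ₗ[A] X)

/-- The relations of the pushout of `K^m → P(i)^m` along `(g₁, …, g_m) : K^m → X`, where `K` is the
kernel of `P(i) → Δ(i)`. -/
def pushoutRelation :
    (Fin m → trace e (i + 1) (P e i)) →ₗ[A] X × (Fin m → P e i) :=
  (-∑ s, g s ∘ₗ LinearMap.proj s).prod
    (LinearMap.pi fun s => (trace e (i + 1) (P e i)).subtype ∘ₗ LinearMap.proj s)

lemma pushoutRelation_fst (c : Fin m → trace e (i + 1) (P e i)) :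
    (pushoutRelation g c).1 = -∑ s, g s (c s) := by
  simp [pushoutRelation]

lemma pushoutRelation_snd (c : Fin m → trace e (i + 1) (P e i)) (s : Fin m) :
    (pushoutRelation g c).2 s = c s := rfl

/-- The extension of `Δ(i)^m` by `X` with components the classes of the homomorphisms `g s`. -/
abbrev Pushout : Type u := (X × (Fin m → P e i)) ⧸ LinearMap.range (pushoutRelation g)

def pushoutInl : X →ₗ[A] Pushout g :=
  (LinearMap.range (pushoutRelation g)).mkQ ∘ₗ LinearMap.inl A X (Fin m → P e i)

def pushoutProj : Pushout g →ₗ[A] (Fin m → Delta e i) :=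
  (LinearMap.range (pushoutRelation g)).liftQ
    ((LinearMap.pi fun s => (trace e (i + 1) (P e i)).mkQ ∘ₗ LinearMap.proj s) ∘ₗ
      LinearMap.snd A X (Fin m → P e i)) (by
    rintro _ ⟨c, rfl⟩
    refine LinearMap.mem_ker.2 (funext fun s => ?_)
    exact (Submodule.Quotient.mk_eq_zero _).2 (c s).2)

lemma pushoutInl_injective : Function.Injective (pushoutInl g) := by
  rw [← LinearMap.ker_eq_bot, LinearMap.ker_eq_bot']
  intro x hx
  obtain ⟨c, hc⟩ := (Submodule.Quotient.mk_eq_zero _).1 hx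
  have hc0 : c = 0 := funext fun s => Subtype.ext (congrFun (congrArg Prod.snd hc) s)
  rw [hc0, map_zero] at hc
  exact (congrArg Prod.fst hc).symm

lemma pushoutProj_surjective : Function.Surjective (pushoutProj g) := by
  intro y
  choose p hp using fun s => (trace e (i + 1) (P e i)).mkQ_surjective (y s)
  exact ⟨Submodule.Quotient.mk (0, p), funext hp⟩

lemma pushout_exact : Function.Exact (pushoutInl g) (pushoutProj g) := by
  intro y
  constructor
  · obtain ⟨⟨x, p⟩, rfl⟩ := Submodule.Quotient.mk_surjective _ y
    intro h
    have hp : ∀ s, p s ∈ trace e (i + 1) (P e i) := fun s =>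
      (Submodule.Quotient.mk_eq_zero _).1 (congrFun h s)
    -- Modulo the relation given by `-p`, the pair `(x, p)` equals `(x + ∑ g s (p s), 0)`.
    refine ⟨x + ∑ s, g s ⟨p s, hp s⟩, ((Submodule.Quotient.eq _).2 ⟨fun s => -⟨p s, hp s⟩, ?_⟩)⟩
    refine Prod.ext ?_ (funext fun s => ?_)
    · rw [pushoutRelation_fst]
      simp
    · rw [pushoutRelation_snd]
      simp
  · rintro ⟨x, rfl⟩
    exact funext fun s => map_zero (trace e (i + 1) (P e i)).mkQ

/-- A map from the kernel of `P(i) → Δ(i)` to the pushout has zero component in `Δ(i)^m`, so it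
factors through `X` and is an `R`-combination of the `g s`. Each `g s` extends to `P(i)` inside the
pushout, by construction. -/
lemma pushout_extZero {R : Type v} [CommRing R] [Algebra R A] (hidem : ∀ j, IsIdempotentElem (e j))
    (hg : ∀ φ : trace e (i + 1) (P e i) →ₗ[A] X, ∃ r : Fin m → R,
      φ = ∑ s, g s ∘ₗ centralSMul A (r s) (trace e (i + 1) (P e i))) :
    ExtZero A (Delta e i) (Pushout g) 1 := by
  have := P_projective (hidem i)
  refine extZero_one_of_exists_extension (Submodule.subtype_injective _) (exact_subtype_mkQ _)
    (Submodule.mkQ_surjective _) fun φ => ?_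
  have h0 : pushoutProj g ∘ₗ φ = 0 := hom_trace_eq_zero hidem (fun j hj x =>
    funext fun s => smul_Delta_eq_zero (Fin.lt_def.2 hj) (x s)) _
  let inlEquiv := LinearEquiv.ofInjective (pushoutInl g) (pushoutInl_injective g)
  let φ' : trace e (i + 1) (P e i) →ₗ[A] X := inlEquiv.symm.toLinearMap ∘ₗ
    φ.codRestrict _ fun c => (pushout_exact g _).1 (LinearMap.congr_fun h0 c)
  have hφ' : ∀ c, pushoutInl g (φ' c) = φ c := fun c =>
    congrArg Subtype.val (inlEquiv.apply_symm_apply _)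
  obtain ⟨r, hr⟩ := hg φ'
  refine ⟨(LinearMap.range (pushoutRelation g)).mkQ ∘ₗ LinearMap.inr A X (Fin m → P e i) ∘ₗ
    LinearMap.pi fun s => centralSMul A (r s) (P e i), LinearMap.ext fun c => ?_⟩
  rw [← hφ']
  refine (Submodule.Quotient.eq _).2
    ⟨fun s => centralSMul A (r s) (trace e (i + 1) (P e i)) c, Prod.ext ?_ (funext fun s => ?_)⟩
  · rw [pushoutRelation_fst]
    change _ = 0 - φ' c
    rw [hr, zero_sub, LinearMap.sum_apply]
    rfl
  · rw [pushoutRelation_snd]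
    simp [centralSMul]

end Pushout

lemma Fil.pi {Θ : ObjectProperty (ModuleCat.{u} A)} (hΘ : IsoClosed Θ) (h : Fil Θ X) (m : ℕ) :
    Fil Θ (Fin m → X) := by
  induction m with
  | zero => exact .of_subsingleton
  | succ m ih =>
    refine .ext hΘ (f := LinearMap.single A (fun _ : Fin (m + 1) => X) 0)
      (g := LinearMap.funLeft A X Fin.succ) (fun x y h => Pi.single_injective 0 h) ?_
      (LinearMap.funLeft_surjective_of_injective A X _ (Fin.succ_injective m)) h ih
    intro y
    constructor
    · intro hy
      refine ⟨y 0, funext fun s => ?_⟩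
      refine Fin.cases (by simp) (fun s => ?_) s
      have : y s.succ = 0 := congrFun hy s
      simp [this]
    · rintro ⟨x, rfl⟩
      refine funext fun s => ?_
      simp [LinearMap.funLeft_apply]

lemma Fil.mono {Θ Θ' : ObjectProperty (ModuleCat.{u} A)} (h : ∀ M, Θ M → Θ' M) (hX : Fil Θ X) :
    Fil Θ' X := by
  induction hX with
  | of_subsingleton => exact .of_subsingleton
  | step _ hQ ih => exact .step ih (h _ hQ)

/-- The class of the standard modules `Δ(i)` with `i < t`. -/
def standardClassBelow (e : Fin n → A) (t : ℕ) : ObjectProperty (ModuleCat.{u} A) :=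
  fun M => ∃ i : Fin n, i < t ∧ Nonempty (M ≃ₗ[A] Delta e i)

lemma standardClassBelow_isoClosed (t : ℕ) : IsoClosed (standardClassBelow e t) :=
  fun _ _ φ ⟨i, hi, ⟨ψ⟩⟩ => ⟨i, hi, ⟨φ.symm.trans ψ⟩⟩

lemma Fil.smul_eq_zero_of_below {t : ℕ} (hidem : ∀ j, IsIdempotentElem (e j))
    (h : Fil (standardClassBelow e t) X) (hj : t ≤ j) (x : X) : e j • x = 0 := by
  induction h with
  | of_subsingleton => exact Subsingleton.elim _ _
  | @step X _ _ N hN hQ ih =>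
    obtain ⟨i, hi, ⟨φ⟩⟩ := hQ
    have h1 : φ (e j • Submodule.Quotient.mk x) = 0 := by
      rw [map_smul]
      exact smul_Delta_eq_zero (Fin.lt_def.2 (hi.trans_le hj)) _
    have h2 : e j • x ∈ N := (Submodule.Quotient.mk_eq_zero N).1 ((map_eq_zero_iff φ φ.injective).1 h1)
    have h3 := congrArg Subtype.val (ih ⟨e j • x, h2⟩)
    simpa [smul_smul, (hidem j).eq] using h3

variable [IsNoetherianRing A]

/-- Every finitely generated module `X` embeds into a module `Y` with `Ext¹(Δ, Y) = 0` such that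
`Y / X` is filtered by standard modules `Δ(i)` with `i < t`, if `Ext¹(Δ(j), X) = 0` for `j ≥ t`. -/
theorem exists_approximation (R : Type v) [CommRing R] [IsNoetherianRing R] [Algebra R A]
    [Module.Finite R A] (hidem : ∀ j, IsIdempotentElem (e j)) (t : ℕ) (ht : t ≤ n)
    (X : Type u) [AddCommGroup X] [Module A X] [Module.Finite A X]
    (hX : ∀ j : Fin n, t ≤ j → ExtZero A (Delta e j) X 1) :
    ∃ (Y : ModuleCat.{u} A) (f : X →ₗ[A] Y), Module.Finite A Y ∧ Function.Injective f ∧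
      (∀ j, ExtZero A (Delta e j) Y 1) ∧
      Fil (standardClassBelow e t) (Y ⧸ LinearMap.range f) := by
  induction t generalizing X with
  | zero =>
    refine ⟨ModuleCat.of A X, LinearMap.id, ‹_›, fun _ _ h => h, fun j => hX j (Nat.zero_le _), ?_⟩
    have : Subsingleton (X ⧸ LinearMap.range (LinearMap.id : X →ₗ[A] X)) := by
      rw [LinearMap.range_id]; infer_instance
    exact .of_subsingleton
  | succ t ih =>
    obtain ⟨i, rfl⟩ : ∃ i : Fin n, (i : ℕ) = t := ⟨⟨t, ht⟩, rfl⟩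
    obtain ⟨m, g, hg⟩ := exists_finite_hom_generators (A := A) R (trace e (i + 1) (P e i)) X
    -- The universal extension kills `Ext¹(Δ(i), -)`. For `j > i` the vanishing already achieved
    -- survives, because `Ext¹(Δ(j), Δ(i)^m) = 0`; this is why indices are treated in descending
    -- order.
    have hY : ∀ j : Fin n, i ≤ (j : ℕ) → ExtZero A (Delta e j) (Pushout g) 1 := by
      intro j hj
      rcases hj.lt_or_eq with h | h
      · exact (hX j h).middle_right (pushoutInl_injective g) (pushout_exact g)
          (pushoutProj_surjective g) (Delta_extZero hidem fun k hk x => funext fun s =>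
            smul_Delta_eq_zero (Fin.lt_def.2 (h.trans hk)) (x s))
      · obtain rfl : i = j := Fin.ext h
        exact pushout_extZero g hidem hg
    obtain ⟨Y, f, hfin, hf, hYext, hfil⟩ := ih (by omega) (Pushout g) hY
    refine ⟨Y, f ∘ₗ pushoutInl g, hfin, hf.comp (pushoutInl_injective g), hYext, ?_⟩
    have hiso := standardClassBelow_isoClosed (e := e) (i + 1)
    -- The image of `α` is a copy of `Δ(i)^m`, and the quotient by it is `Y` modulo the pushout,
    -- which is filtered by induction.
    let α : Pushout g →ₗ[A] Y ⧸ LinearMap.range (f ∘ₗ pushoutInl g) := Submodule.mkQ _ ∘ₗ f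
    have hα : LinearMap.ker α = LinearMap.ker (pushoutProj g) := by
      ext y
      rw [LinearMap.mem_ker, LinearMap.mem_ker, pushout_exact g y]
      refine (Submodule.Quotient.mk_eq_zero _).trans ⟨?_, ?_⟩
      · rintro ⟨x, hx⟩
        exact ⟨x, hf hx⟩
      · rintro ⟨x, rfl⟩
        exact ⟨x, rfl⟩
    have hrange : Fil (standardClassBelow e (i + 1)) (LinearMap.range α) :=
      ((Fil.of_mem hiso (M := Delta e i) ⟨i, Nat.lt_succ_self _, ⟨.refl A _⟩⟩).pi hiso m).equiv hiso
        (((pushoutProj g).quotKerEquivOfSurjective (pushoutProj_surjective g)).symm.trans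
          ((Submodule.quotEquivOfEq _ _ hα.symm).trans α.quotKerEquivRange))
    have hle : LinearMap.range (f ∘ₗ pushoutInl g) ≤ LinearMap.range f :=
      LinearMap.range_comp_le_range _ _
    refine .ext hiso (f := (LinearMap.range α).subtype) (g := Submodule.factor hle)
      (Submodule.subtype_injective _) (submodule_exact_subtype ?_) (Submodule.factor_surjective hle)
      hrange (hfil.mono fun M ⟨k, hk, hφ⟩ => ⟨k, by omega, hφ⟩)
    ext y
    obtain ⟨y, rfl⟩ := Submodule.Quotient.mk_surjective _ y
    rw [LinearMap.mem_ker]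
    refine (Submodule.Quotient.mk_eq_zero (LinearMap.range f)).trans ⟨?_, ?_⟩
    · rintro ⟨x, rfl⟩
      exact ⟨x, rfl⟩
    · rintro ⟨x, hx⟩
      have h1 : f x - y ∈ LinearMap.range (f ∘ₗ pushoutInl g) := (Submodule.Quotient.eq _).1 hx
      have := (LinearMap.range f).sub_mem ⟨x, rfl⟩ (hle h1)
      simpa using this

end UniversalExtensions

/-! ### Good filtration dimension through Ext from the characteristic module. -/

section GoodFiltrationDimension

variable {A : Type u} [Ring A] {n : ℕ} {e : Fin n → A} {T : Fin n → ModuleCat.{u} A}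
  {X : Type u} [AddCommGroup X] [Module A X]

lemma extZero_of_isInAdd {T M : ModuleCat.{u} A} (h : IsInAdd T M) {k : ℕ}
    (hT : ExtZero A T X k) : ExtZero A M X k := by
  obtain ⟨m, s, r, hrs⟩ := h
  refine ExtZero.of_sum_comp (J := Fin m) (N := fun _ => T)
    (fun i => r ∘ₗ LinearMap.single A (fun _ => T) i) (fun i => LinearMap.proj i ∘ₗ s) ?_
    fun _ => hT
  ext x
  simp only [LinearMap.sum_apply, LinearMap.comp_apply, LinearMap.id_apply]
  rw [← map_sum]
  refine Eq.trans (congrArg r ?_) (LinearMap.congr_fun hrs x)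
  exact LinearMap.sum_single_apply (fun _ => T) (s x)

lemma isInAdd_self (T : ModuleCat.{u} A) : IsInAdd T T :=
  ⟨1, LinearMap.pi fun _ => LinearMap.id, LinearMap.proj 0, rfl⟩

lemma extZero_total_iff {k : ℕ} :
    ExtZero A (total T) X k ↔ ∀ l, ExtZero A (T l) X k := by
  classical
  refine ⟨fun h l => ExtZero.of_retract (DirectSum.lof A (Fin n) (fun i => T i) l)
    (DirectSum.component A (Fin n) (fun i => T i) l)
    (LinearMap.ext fun x => DirectSum.component.lof_self (M := fun i => T i) A l x) h, fun h => ?_⟩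
  refine ExtZero.of_sum_comp (J := Fin n) (N := fun l => T l)
    (fun l => DirectSum.lof A (Fin n) (fun i => T i) l)
    (fun l => DirectSum.component A (Fin n) (fun i => T i) l) ?_ h
  refine LinearMap.ext fun x => ?_
  rw [LinearMap.sum_apply]
  exact DirectSum.sum_univ_of x

variable [IsArtinianRing A] [IsNoetherianRing A]

lemma IsCharacteristic.fil_total (he : IsBasicIdempotentSystem e) (hT : IsCharacteristic e T) :
    Fil (standardClass e) (total T) :=
  ((hT.add_eq _).1 (isInAdd_self _)).1.fil (standardClass_isoClosed he)

lemma Fil.standardBelow (he : IsBasicIdempotentSystem e) {M : Type u} [AddCommGroup M] [Module A M]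
    (hM : Fil (standardClass e) M) : Fil (standardClassBelow e n) M :=
  hM.mono fun N ⟨i, hi⟩ => ⟨i, i.2, (isStandard_iff he N).1 hi⟩

lemma Fil.standard (he : IsBasicIdempotentSystem e) {t : ℕ} {M : Type u} [AddCommGroup M]
    [Module A M] (hM : Fil (standardClassBelow e t) M) : Fil (standardClass e) M :=
  hM.mono fun N ⟨i, _, hi⟩ => ⟨i, (isStandard_iff he N).2 hi⟩

/-- Since every module in `F(Δ)` has a finite coresolution by modules in `add T`, the vanishing of
`Ext^i(T, X)` in all degrees `i ≥ d` extends to `Ext^i(F(Δ), X)`. -/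
theorem fil_extZero_of_total (R : Type v) [CommRing R] [IsArtinianRing R] [Algebra R A]
    [Module.Finite R A] (he : IsBasicIdempotentSystem e) (hA : IsStandardlyStratified e)
    (hT : IsCharacteristic e T) {d : ℕ} (hX : ∀ i, d ≤ i → ExtZero A (total T) X i) (t : ℕ)
    (ht : t ≤ n) {M : Type u} [AddCommGroup M] [Module A M] (hM : Fil (standardClassBelow e t) M)
    (i : ℕ) (hi : d ≤ i) : ExtZero A M X i := by
  have hidem := fun j => (he.primitive j).1
  induction t generalizing M i with
  | zero =>
    have : Subsingleton M := ⟨fun x y => by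
      rw [← sum_smul he x, ← sum_smul he y]
      refine Finset.sum_congr rfl fun j _ => ?_
      rw [hM.smul_eq_zero_of_below hidem (Nat.zero_le _),
        hM.smul_eq_zero_of_below hidem (Nat.zero_le _)]⟩
    exact extZero_of_subsingleton_left i
  | succ t ih =>
    have hstd := hM.standard he
    have hfin := hstd.finite (standardClass_finite he)
    -- `M` only involves `Δ(l)` with `l ≤ t`, so `Ext¹(Δ(j), M) = 0` for `j ≥ t` and the cokernel
    -- needs only indices below `t`. This makes the induction on `t` work.
    obtain ⟨Y, f, hYfin, hf, hY, hC⟩ := exists_approximation R hidem t (by omega) M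
      fun j hj => Delta_extZero hidem fun k hk x => hM.smul_eq_zero_of_below hidem
        (by have := Fin.lt_def.1 hk; omega) x
    have hexact : Function.Exact f (LinearMap.range f).mkQ := by
      rw [LinearMap.exact_iff, Submodule.ker_mkQ]
    have hYstd := Fil.ext (standardClass_isoClosed he) hf hexact (Submodule.mkQ_surjective _)
      hstd (hC.standard he)
    have hYadd : IsInAdd (total T) Y := (hT.add_eq Y).2
      ⟨hYstd.filtered (standardClass_isoClosed he),
        (fil_properCostandard_of_extZero R he hA hY).filtered properCostandardClass_isoClosed⟩
    -- `Ext^i(M, X)` sits between `Ext^i(Y, X)` and `Ext^(i+1)(C, X)`; the shift in degree is why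
    -- vanishing in all degrees `≥ d` is assumed.
    exact (extZero_of_isInAdd hYadd (hX i hi)).sub_left hf hexact (Submodule.mkQ_surjective _)
      (ih (by omega) hC (i + 1) (by omega))


/-- Dimension shifting: the image of `M 0 → M 1` has a coresolution shorter by one, and the terms in
`F(∇̄)` contribute nothing in positive degrees. -/
lemma extZero_total_of_hasGoodCoresolution (he : IsBasicIdempotentSystem e)
    (hA : IsStandardlyStratified e) (hT : IsCharacteristic e T) {d : ℕ} {X : ModuleCat.{u} A}
    (h : HasGoodCoresolution e X d) (i : ℕ) (hi : d < i) : ExtZero A (total T) X i := by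
  induction d generalizing X i with
  | zero =>
    obtain ⟨M, ε, f, hε, hεf, -, hM, hzero⟩ := h
    obtain ⟨i, rfl⟩ := Nat.exists_eq_succ_of_ne_zero hi.ne'
    have := hzero 1 Nat.one_pos
    refine .of_equiv_right (LinearEquiv.ofBijective ε ⟨hε, fun x =>
      (hεf x).1 (Subsingleton.elim (α := M 1) _ _)⟩) ?_
    exact fil_extZero_fil he hA i (hT.fil_total he)
      ((hM 0 le_rfl).fil properCostandardClass_isoClosed)
  | succ d ih =>
    obtain ⟨M, ε, f, hε, hεf, hff, hM, hzero⟩ := h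
    obtain ⟨i, rfl⟩ := Nat.exists_eq_succ_of_ne_zero (Nat.ne_zero_of_lt hi)
    have hQ : HasGoodCoresolution e (ModuleCat.of A (LinearMap.range (f 0))) d := by
      refine ⟨fun k => M (k + 1), (LinearMap.range (f 0)).subtype, fun k => f (k + 1),
        Submodule.subtype_injective _, submodule_exact_subtype ?_, fun k => hff (k + 1),
        fun k hk => hM (k + 1) (by omega), fun k hk => hzero (k + 1) (by omega)⟩
      exact (LinearMap.exact_iff.1 (hff 0))
    refine ExtZero.sub_right (f := ε) (g := (f 0).rangeRestrict) hε ?_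
      (f 0).surjective_rangeRestrict (ih hQ i (by omega))
      (fil_extZero_fil he hA i (hT.fil_total he)
        ((hM 0 (Nat.zero_le _)).fil properCostandardClass_isoClosed))
    intro x
    rw [← hεf x, Subtype.ext_iff]
    rfl

omit [IsArtinianRing A] [IsNoetherianRing A] in
lemma HasGoodCoresolution.of_fil {X : ModuleCat.{u} A} (hX : Fil (properCostandardClass e) X) :
    HasGoodCoresolution e X 0 := by
  refine ⟨fun k => k.casesOn X fun _ => ModuleCat.of A PUnit, LinearMap.id, fun _ => 0,
    fun _ _ h => h, fun x => ⟨fun _ => ⟨x, rfl⟩, fun _ => rfl⟩,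
    fun k x => ⟨fun _ => ⟨0, Subsingleton.elim (α := PUnit) _ _⟩, fun _ => rfl⟩, ?_, ?_⟩
  · intro k hk
    obtain rfl := Nat.le_zero.1 hk
    exact hX.filtered properCostandardClass_isoClosed
  · rintro (_ | k) hk
    · omega
    · exact inferInstanceAs (Subsingleton PUnit)

/-- The family `Y, M₀, M₁, …`. -/
def consFamily (Y : ModuleCat.{u} A) (M : ℕ → ModuleCat.{u} A) : ℕ → ModuleCat.{u} A
  | 0 => Y
  | k + 1 => M k

/-- The maps of the sequence `Y → M₀ → M₁ → ⋯`. -/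
def consMap {Y : ModuleCat.{u} A} {M : ℕ → ModuleCat.{u} A} (φ : ∀ k, M k →ₗ[A] M (k + 1))
    (g : Y →ₗ[A] M 0) : ∀ k, consFamily Y M k →ₗ[A] consFamily Y M (k + 1)
  | 0 => g
  | k + 1 => φ k

omit [IsArtinianRing A] [IsNoetherianRing A] in
lemma HasGoodCoresolution.cons {X Y C : ModuleCat.{u} A} {f : X →ₗ[A] Y} {g : Y →ₗ[A] C}
    (hf : Function.Injective f) (hfg : Function.Exact f g) (hg : Function.Surjective g) {d : ℕ}
    (hY : Fil (properCostandardClass e) Y) (hC : HasGoodCoresolution e C d) :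
    HasGoodCoresolution e X (d + 1) := by
  obtain ⟨M, ε, φ, hε, hεφ, hφ, hM, hzero⟩ := hC
  refine ⟨consFamily Y M, f, consMap φ (ε ∘ₗ g), hf, fun y => ?_, ?_, ?_, ?_⟩
  · exact (map_eq_zero_iff ε hε).trans (hfg y)
  · rintro (_ | k)
    · intro y
      refine (hεφ y).trans ⟨?_, ?_⟩
      · rintro ⟨c, rfl⟩
        obtain ⟨z, rfl⟩ := hg c
        exact ⟨z, rfl⟩
      · rintro ⟨z, rfl⟩
        exact ⟨g z, rfl⟩
    · exact hφ k
  · rintro (_ | k) hk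
    · exact hY.filtered properCostandardClass_isoClosed
    · exact hM k (by omega)
  · rintro (_ | k) hk
    · omega
    · exact hzero k (by omega)

/-- Passing to the cokernel of an approximation lowers the vanishing bound by one. At bound zero,
vanishing passes from `T` to every `Δ(i)`, and `X` itself is in `F(∇̄)`. -/
lemma hasGoodCoresolution_of_extZero_total (R : Type v) [CommRing R] [IsArtinianRing R] [Algebra R A]
    [Module.Finite R A] (he : IsBasicIdempotentSystem e)
    (hA : IsStandardlyStratified e) (hT : IsCharacteristic e T) {d : ℕ} {X : ModuleCat.{u} A}
    [Module.Finite A X] (h : ∀ i, d < i → ExtZero A (total T) X i) :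
    HasGoodCoresolution e X d := by
  have hidem := fun j => (he.primitive j).1
  induction d generalizing X with
  | zero =>
    exact .of_fil (fil_properCostandard_of_extZero R he hA fun i =>
      fil_extZero_of_total R he hA hT (d := 1) h n le_rfl ((fil_Delta he).standardBelow he) 1 le_rfl)
  | succ d ih =>
    obtain ⟨Y, f, hYfin, hf, hY, hC⟩ := exists_approximation R hidem n le_rfl X
      fun j hj => absurd j.2 (by omega)
    have hexact : Function.Exact f (LinearMap.range f).mkQ := by
      rw [LinearMap.exact_iff, Submodule.ker_mkQ]
    have hYfil := fil_properCostandard_of_extZero R he hA hY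
    refine .cons (C := ModuleCat.of A (Y ⧸ LinearMap.range f)) hf hexact
      (Submodule.mkQ_surjective _) hYfil (ih fun i hi => ?_)
    obtain ⟨i, rfl⟩ := Nat.exists_eq_succ_of_ne_zero (Nat.ne_zero_of_lt hi)
    exact (fil_extZero_fil he hA i (hT.fil_total he) hYfil).quot_right hf hexact
      (Submodule.mkQ_surjective _) (h (i + 2) (by omega))

lemma iInf_coe_eq_coe_iff {p : ℕ → Prop} (d : ℕ) :
    (⨅ (k : ℕ) (_ : p k), (k : ℕ∞)) = (d : ℕ∞) ↔ p d ∧ ∀ k < d, ¬ p k := by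
  classical
  by_cases h : ∃ k, p k
  · have : (⨅ (k : ℕ) (_ : p k), (k : ℕ∞)) = (Nat.find h : ℕ∞) :=
      le_antisymm (iInf₂_le _ (Nat.find_spec h))
        (le_iInf₂ fun k hk => Nat.cast_le.2 (Nat.find_min' h hk))
    rw [this, Nat.cast_inj, Nat.find_eq_iff]
  · push Not at h
    simp [h]

end GoodFiltrationDimension

end StandardlyStratified

open StandardlyStratified in
theorem proposition2p1 {R : Type v} [CommRing R] [IsArtinianRing R]
    {A : Type u} [Ring A] [Algebra R A] [Module.Finite R A]
    {n : ℕ} (e : Fin n → A) (he : StandardlyStratified.IsBasicIdempotentSystem e)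
    (hA : StandardlyStratified.IsStandardlyStratified e)
    (T : Fin n → ModuleCat.{u} A) (hT : StandardlyStratified.IsCharacteristic e T)
    (X : ModuleCat.{u} A) [Module.Finite A X] [Nontrivial X] (d : ℕ) :
    StandardlyStratified.goodFiltrationDimension e X = (d : ℕ∞) ↔
      (∀ i : ℕ, d < i → Subsingleton
        (CategoryTheory.Abelian.Ext.{u} (StandardlyStratified.total T) X i)) ∧
      ∃ l : Fin n, Nontrivial (CategoryTheory.Abelian.Ext.{u} (T l) X d) := by
  have : IsArtinianRing A := IsArtinianRing.of_finite R A
  have : IsNoetherianRing A := isNoetherian_of_tower R inferInstance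
  have hiff : ∀ k, HasGoodCoresolution e X k ↔ ∀ i, k < i → ExtZero A (total T) X i := fun k =>
    ⟨extZero_total_of_hasGoodCoresolution he hA hT, hasGoodCoresolution_of_extZero_total R he hA hT⟩
  rw [goodFiltrationDimension, iInf_coe_eq_coe_iff]
  simp only [hiff]
  refine and_congr_right fun hd => ⟨fun hmin => ?_, ?_⟩
  · by_contra! hsub
    have htotal : ∀ i, d ≤ i → ExtZero A (total T) X i := by
      intro i hi
      rcases hi.lt_or_eq with h | rfl
      · exact hd i h
      · exact extZero_total_iff.2 fun l => hsub l
    rcases d with _ | d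
    -- For `d = 0` there is no smaller length to contradict. Instead, vanishing in all degrees
    -- including zero passes to `A ∈ F(Δ)`, so `Hom(A, X) = 0`, against `X ≠ 0`.
    · have hAA := fil_extZero_of_total R he hA hT htotal n le_rfl
        ((hA.fil (standardClass_isoClosed he)).standardBelow he) 0 le_rfl
      obtain ⟨x, hx⟩ := exists_ne (0 : X)
      refine hx ?_
      rw [← one_smul A x, ← LinearMap.toSpanSingleton_apply,
        extZero_zero_iff.1 hAA (LinearMap.toSpanSingleton A X x), LinearMap.zero_apply]
    · exact hmin d (Nat.lt_succ_self d) fun i hi => htotal i hi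
  · rintro ⟨l, hl⟩ k hk hvanish
    exact not_subsingleton_iff_nontrivial.2 hl (extZero_total_iff.1 (hvanish d hk) l)
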